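/- Let $E$ be a finite totally ordered set. A simplicial complex on $E$ is a family $\Delta\subseteq 2^E$ (possibly empty) such that $G\subseteq H\in\Delta$ implies $G\in\Delta$. It is shifted if, whenever $H=\{h_1<\dots<h_k\}\in\Delta$ and $G=\{g_1<\dots<g_k\}\subseteq E$ satisfy $g_p\le h_p$ for all $p$, also $G\in\Delta$. A shifted interval on $E$ is a set $\Phi=\Delta\setminus\Delta'$, where $\Delta'\subseteq\Delta$ are simplicial complexes that are both shifted on $E$. For a family $\Phi\subseteq 2^E$ and $e\in E$ put $$\Phi-e=\{F\in\Phi: e\notin F\},\qquad \Phi/e=\{F\setminus\{e\}: F\in\Phi,\ e\in F\},$$ and let $\Phi\,||\,e$ be obtained from $\Phi$ by removing both members of every pair $F,\,F\cup\{e\}$ with $e\notin F$ and $F,\,F\cup\{e\}\in\Phi$. Let $C_i(\Phi)$ be the real vector space with basis the faces $F\in\Phi$ with $|F|=i+1$ (so $C_{-1}$ is spanned by $\emptyset$ if $\emptyset\in\Phi$). Let $\partial_i:C_i(\Phi)\to C_{i-1}(\Phi)$ be the usual signed simplicial boundary operator, where faces not in $\Phi$ are omitted, and let $\partial_i^*$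 be its transpose in the bases of faces. Let $L_i(\Phi)=\partial_{i+1}\partial_{i+1}^*+\partial_i^*\partial_i$, and let $\mathbf s_i(\Phi)$ be the multiset of its (real) eigenvalues. Define $$S_\Phi(t,q)=\sum_{i\ge 0}t^i\sum_{\lambda\in\mathbf s_{i-1}(\Phi)}q^\lambda,$$ a formal finite sum in which the exponents of $q$ may be real. Theorem. Every shifted interval $\Phi$ on $E$ satisfies the spectral recursion with respect to every vertex: for every $e\in E$ (including those $e$ that lie in no face of $\Phi$), $$S_\Phi(t,q)=q\,S_{\Phi-e}(t,q)+qt\,S_{\Phi/e}(t,q)+(1-q)\,S_{\Phi||e}(t,q).$$ -/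

import Mathlib

noncomputable section

namespace ShiftedInterval

variable {α : Type*} [LinearOrder α]

/-! ### Complexes and intervals on a finite, linearly ordered ground set -/

/-- `Δ ⊆ 2^E` is a simplicial complex: it is closed under taking subsets
(the void complex, without any face, is allowed). -/
def IsComplex (E : Finset α) (Δ : Finset (Finset α)) : Prop :=
  (∀ F ∈ Δ, F ⊆ E) ∧ ∀ G H : Finset α, G ⊆ H → H ∈ Δ → G ∈ Δ

/-- The componentwise partial order: `F = {f₁ < ⋯ < f_k}`, `G = {g₁ < ⋯ < g_k}`
have the same size and `f_p ≤ g_p` for all `p`. -/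
def CompLE (F G : Finset α) : Prop :=
  ∃ (k : ℕ) (hF : F.card = k) (hG : G.card = k),
    ∀ p : Fin k, F.orderEmbOfFin hF p ≤ G.orderEmbOfFin hG p

/-- `Δ` is a shifted simplicial complex on the ordered vertex set `E`. -/
def IsShiftedComplex (E : Finset α) (Δ : Finset (Finset α)) : Prop :=
  IsComplex E Δ ∧ ∀ G H : Finset α, G ⊆ E → CompLE G H → H ∈ Δ → G ∈ Δ

/-- `Φ` is a shifted interval with ground set `E`: a relative pair `(Δ, Δ') = Δ - Δ'` of
complexes `Δ' ⊆ Δ` that are both shifted on `E`. -/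
def IsShiftedInterval (E : Finset α) (Φ : Finset (Finset α)) : Prop :=
  ∃ Δ Δ' : Finset (Finset α),
    IsShiftedComplex E Δ ∧ IsShiftedComplex E Δ' ∧ Δ' ⊆ Δ ∧ Φ = Δ \ Δ'

/-- The deletion `Φ - e`. -/
def deletion (Φ : Finset (Finset α)) (e : α) : Finset (Finset α) :=
  Φ.filter fun F => e ∉ F

/-- The contraction `Φ / e`. -/
def contraction (Φ : Finset (Finset α)) (e : α) : Finset (Finset α) :=
  (Φ.filter fun F => e ∈ F).image fun F => F.erase e

/-- The star of `e` in `Φ`: the union of all pairs `{F, F ∪ e}` with `e ∉ F` whose two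
members are both in `Φ`. -/
def starOf (Φ : Finset (Finset α)) (e : α) : Finset (Finset α) :=
  (Φ.filter fun F => e ∉ F ∧ insert e F ∈ Φ).biUnion fun F => {F, insert e F}

/-- The reduction `Φ || e`. -/
def reduction (Φ : Finset (Finset α)) (e : α) : Finset (Finset α) :=
  Φ \ starOf Φ e

/-! ### Laplacians and the spectrum polynomial -/

/-- `Φ_i`, the set of faces of dimension `i`, where `dim F = |F| - 1` (so `dim ∅ = -1`). -/
abbrev Faces (Φ : Finset (Finset α)) (i : ℤ) : Type _ :=
  {F : Finset α // F ∈ Φ.filter fun F => (F.card : ℤ) - 1 = i}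

/-- The coefficient of `[G]` in the simplicial boundary
`∑_p (-1)^p [F - v_p]` of `F = {v_0 < v_1 < ⋯}`. -/
def incidence (G F : Finset α) : ℝ :=
  ∑ v ∈ F, if F.erase v = G then (-1) ^ (F.filter fun u => u < v).card else 0

/-- The matrix, in the bases of faces, of the boundary operator from `i`-chains to `j`-chains
of `Φ`; it is used for `j = i - 1` (it vanishes for other `j`). -/
def boundary (Φ : Finset (Finset α)) (j i : ℤ) : Matrix (Faces Φ j) (Faces Φ i) ℝ :=
  Matrix.of fun G F => incidence G.1 F.1

/-- The Laplacian `L_i = ∂_{i+1} ∂_{i+1}^* + ∂_i^* ∂_i`. -/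
def laplacian (Φ : Finset (Finset α)) (i : ℤ) : Matrix (Faces Φ i) (Faces Φ i) ℝ :=
  boundary Φ i (i + 1) * (boundary Φ i (i + 1)).transpose +
    (boundary Φ (i - 1) i).transpose * boundary Φ (i - 1) i

/-- The multiset `s_i(Φ)` of eigenvalues of `L_i(Φ)`, with multiplicities. -/
def laplacianSpectrum (Φ : Finset (Finset α)) (i : ℤ) : Multiset ℝ :=
  (laplacian Φ i).charpoly.roots

/-- The formal power `q ^ c` with real exponent `c`, in the ring of finite formal integer
combinations of such powers. -/
def qpow (c : ℝ) : AddMonoidAlgebra ℤ ℝ :=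
  AddMonoidAlgebra.single c 1

/-- The spectrum polynomial
`S_Φ(t, q) = ∑_{i ≥ 0} t^i ∑_{c ∈ s_{i-1}(Φ)} q^c`, a polynomial in `t = Polynomial.X` whose
coefficients are formal combinations of real powers of `q`. The sum stops at the largest
size of a face; the later terms are zero. -/
def spectrumPoly (Φ : Finset (Finset α)) : Polynomial (AddMonoidAlgebra ℤ ℝ) :=
  ∑ i ∈ Finset.range (Φ.sup Finset.card + 1),
    Polynomial.X ^ i * Polynomial.C ((laplacianSpectrum Φ ((i : ℤ) - 1)).map qpow).sum

/-- `Φ` satisfies the spectral recursion with respect to `e`: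
`S_Φ = q S_{Φ-e} + q t S_{Φ/e} + (1 - q) S_{Φ||e}`. -/
def SpectralRecursionAt (Φ : Finset (Finset α)) (e : α) : Prop :=
  spectrumPoly Φ =
    Polynomial.C (qpow 1) * spectrumPoly (deletion Φ e) +
      Polynomial.C (qpow 1) * Polynomial.X * spectrumPoly (contraction Φ e) +
      (1 - Polynomial.C (qpow 1)) * spectrumPoly (reduction Φ e)

/-- `Φ`, with ground set `E`, satisfies the spectral recursion: it does so with respect to
every vertex. -/
def SatisfiesSpectralRecursion (E : Finset α) (Φ : Finset (Finset α)) : Prop :=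
  ∀ e ∈ E, SpectralRecursionAt Φ e

end ShiftedInterval

end

noncomputable section

namespace ShiftedInterval

variable {α : Type*} [LinearOrder α]

/-! ### Incidence numbers -/

/-! Shiftedness is used only as an exchange property: a vertex of a face may be replaced by a
smaller vertex of E. For the least vertex a of E this makes Φ an interval of near-cones with apex a,
and the recursion at a becomes linear algebra.

All operators are extended by zero to the subsets of E, so that the boundaries of Φ, Φ-a and Φ/a are
square matrices of one size. Let A and D be the boundaries of Φ-a and Φ/a, let B consist of the F
with a ∉ F and both F and F ∪ a in Φ, and let p be the projection onto the chains of B in the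
relevant dimension. From ∂(a*σ) = σ - a*∂σ, the boundary of Φ factors as PQ with PᵀP = p + DᵀD and
QQᵀ = p + AAᵀ (`cone_factorization`). Since DA = 0, both ∂∂ᵀ and ∂ᵀ∂ have the characteristic
polynomial of p + AAᵀ + DᵀD: up to eigenvalues 0 and 1, its spectrum is that of AAᵀ and DᵀD raised
by one. Combining dimensions i and i+1, and finding the multiplicities of 0 and 1 by counting faces,
gives `IsNearConeInterval.charpoly_laplacian`. No two faces of Φ||a are incident, so its spectrum
consists of zeros and S_{Φ||a} is the face polynomial f(Φ||a); the recursion at a follows.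

For e ≠ a, induct on |E|. Deletion, contraction and reduction by e all keep the apex a, so the
recursion at a applies to Φ, Φ-e, Φ/e and Φ||e, while induction gives the recursion at e for Φ-a and
Φ/a. Operations at a and at e commute where needed, and what remains is an identity of face
polynomials. It follows from f((Φ||e)||a) = f(Φ||a)
(`IsNearConeInterval.facePoly_reduction_reduction`) and from splitting f(Φ||a) by whether a face
contains e. -/

theorem incidence_eq_zero {G F : Finset α} (h : ∀ v ∈ F, F.erase v ≠ G) : incidence G F = 0 :=
  Finset.sum_eq_zero fun v hv => if_neg (h v hv)

theorem exists_of_incidence_ne_zero {G F : Finset α} (h : incidence G F ≠ 0) :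
    ∃ v ∈ F, F.erase v = G := by
  by_contra! h'
  exact h (incidence_eq_zero h')

theorem incidence_erase {F : Finset α} {v : α} (hv : v ∈ F) :
    incidence (F.erase v) F = (-1) ^ (F.filter fun u => u < v).card := by
  rw [incidence, Finset.sum_eq_single_of_mem v hv, if_pos rfl]
  intro w hw hwv
  refine if_neg fun h => hwv ?_
  by_contra hne
  have : w ∈ F.erase v := Finset.mem_erase.2 ⟨hne, hw⟩
  rw [← h] at this
  simp at this

theorem incidence_insert_self {F : Finset α} {a : α} (ha : ∀ x ∈ F, a < x) :
    incidence F (insert a F) = 1 := by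
  have haF : a ∉ F := fun h => lt_irrefl _ (ha a h)
  have := incidence_erase (Finset.mem_insert_self a F)
  rw [Finset.erase_insert haF] at this
  rw [this]
  have h0 : ((insert a F).filter fun u => u < a) = ∅ := by
    ext x
    simp only [Finset.mem_filter, Finset.mem_insert, Finset.notMem_empty, iff_false]
    rintro ⟨rfl | h, h'⟩
    · exact lt_irrefl _ h'
    · exact lt_asymm h' (ha x h)
  rw [h0]; simp

/-- The new least vertex precedes every vertex of F, so each sign exponent grows by one. Together
with `incidence_insert_self` this is ∂(a*σ) = σ - a*∂σ. -/
theorem incidence_insert_insert {G F : Finset α} {a : α} (ha : ∀ x ∈ F, a < x) (hG : a ∉ G) :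
    incidence (insert a G) (insert a F) = -incidence G F := by
  have haF : a ∉ F := fun h => lt_irrefl _ (ha a h)
  rw [incidence, Finset.sum_insert haF, if_neg, zero_add, incidence, ← Finset.sum_neg_distrib]
  · refine Finset.sum_congr rfl fun v hv => ?_
    have hav : a ≠ v := (ha v hv).ne
    have h1 : (insert a F).erase v = insert a (F.erase v) := Finset.erase_insert_of_ne hav
    have h2 : insert a (F.erase v) = insert a G ↔ F.erase v = G := by
      constructor
      · intro h
        have := congrArg (fun s => Finset.erase s a) h
        simpa [Finset.erase_insert hG, haF] using this
      · rintro rfl; rfl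
    have h3 : ((insert a F).filter fun u => u < v).card = (F.filter fun u => u < v).card + 1 := by
      rw [Finset.filter_insert, if_pos (ha v hv), Finset.card_insert_of_notMem]
      simp [haF]
    simp only [h1, h2, h3]
    split_ifs <;> ring
  · rw [Finset.erase_insert haF]
    rintro rfl
    exact haF (Finset.mem_insert_self _ _)

theorem incidence_sign_swap {F : Finset α} {v w : α} (hv : v ∈ F) (h : v < w) :
    ((-1) ^ (F.filter fun u => u < v).card * (-1) ^ ((F.erase v).filter fun u => u < w).card : ℝ) =
      -((-1) ^ (F.filter fun u => u < w).card *
        (-1) ^ ((F.erase w).filter fun u => u < v).card) := by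
  have h1 : (F.erase w).filter (fun u => u < v) = F.filter fun u => u < v := by
    ext x
    simp only [Finset.mem_filter, Finset.mem_erase]
    constructor
    · rintro ⟨⟨-, h1⟩, h2⟩; exact ⟨h1, h2⟩
    · rintro ⟨h1, h2⟩; exact ⟨⟨(h2.trans h).ne, h1⟩, h2⟩
  have h2 : (F.filter fun u => u < w).card = ((F.erase v).filter fun u => u < w).card + 1 := by
    rw [Finset.filter_erase, Finset.card_erase_add_one]
    simp [hv, h]
  rw [h1, h2]; ring

/-- The square of the simplicial boundary operator vanishes. -/
theorem sum_incidence_mul_incidence {E F : Finset α} (hF : F ⊆ E) (G : Finset α) :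
    ∑ H ∈ E.powerset, incidence G H * incidence H F = 0 := by
  set f : α → α → ℝ := fun v w => if (F.erase v).erase w = G then
    (-1) ^ (F.filter fun u => u < v).card * (-1) ^ ((F.erase v).filter fun u => u < w).card
    else 0 with hf
  have h1 : ∑ H ∈ E.powerset, incidence G H * incidence H F =
      ∑ v ∈ F, ∑ w ∈ F.erase v, f v w := by
    simp only [incidence.eq_1 _ F, Finset.mul_sum]
    rw [Finset.sum_comm]
    refine Finset.sum_congr rfl fun v hv => ?_
    rw [Finset.sum_eq_single_of_mem (F.erase v)]
    · rw [if_pos rfl, incidence, Finset.sum_mul]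
      refine Finset.sum_congr rfl fun w hw => ?_
      simp only [hf]
      split_ifs <;> ring
    · exact Finset.mem_powerset.2 ((Finset.erase_subset _ _).trans hF)
    · intro H _ hH
      rw [if_neg (Ne.symm hH), mul_zero]
  -- Removing v and w in the other order flips the sign, so the double sum equals its own negative.
  have hanti : ∀ v ∈ F, ∀ w ∈ F, v ≠ w → f v w = -f w v := by
    intro v hv w hw hvw
    simp only [hf, Finset.erase_right_comm (a := w)]
    split_ifs
    · rcases lt_or_gt_of_ne hvw with h | h
      · exact incidence_sign_swap hv h
      · rw [incidence_sign_swap hw h, neg_neg]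
    · simp
  have h2 : ∑ v ∈ F, ∑ w ∈ F.erase v, f v w = ∑ w ∈ F, ∑ v ∈ F.erase w, f v w := by
    refine Finset.sum_comm' fun v w => ?_
    simp only [Finset.mem_erase]
    tauto
  have h3 : ∑ w ∈ F, ∑ v ∈ F.erase w, f v w = -∑ w ∈ F, ∑ v ∈ F.erase w, f w v := by
    rw [← Finset.sum_neg_distrib]
    refine Finset.sum_congr rfl fun w hw => ?_
    rw [← Finset.sum_neg_distrib]
    refine Finset.sum_congr rfl fun v hv => ?_
    rw [Finset.mem_erase] at hv
    exact hanti v hv.2 w hw hv.1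
  rw [h1]
  linarith

/-! ### Characteristic polynomials -/

section Charpoly

open Polynomial Matrix

variable {T : Type*} [Fintype T] [DecidableEq T]

/-- If UV = 0, then (X - U)(X - V) = X(X - (U + V)); take determinants. -/
theorem charpoly_add_of_mul_eq_zero {U V : Matrix T T ℝ} (h : U * V = 0) :
    X ^ Fintype.card T * (U + V).charpoly = U.charpoly * V.charpoly := by
  simp only [Matrix.charpoly]
  rw [← Matrix.det_mul]
  have : charmatrix U * charmatrix V = (X : ℝ[X]) • charmatrix (U + V) := by
    have hUV : (C.mapMatrix U) * (C.mapMatrix V) = (0 : Matrix T T ℝ[X]) := by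
      rw [← map_mul, h, map_zero]
    simp only [charmatrix, map_add]
    have hc : Matrix.scalar T (X : ℝ[X]) = (X : ℝ[X]) • (1 : Matrix T T ℝ[X]) := by
      rw [Matrix.smul_one_eq_diagonal]; rfl
    rw [hc]
    simp only [sub_mul, mul_sub, hUV, smul_mul_assoc, mul_smul_comm, one_mul, mul_one, smul_sub,
      smul_add]
    abel
  rw [this, Matrix.det_smul]

theorem charpoly_one_add (M : Matrix T T ℝ) :
    (1 + M).charpoly = M.charpoly.comp (X - C 1) := by
  have : (1 + M).charpoly = (M - Matrix.scalar T (-1)).charpoly := by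
    congr 1
    rw [map_neg, sub_neg_eq_add, map_one, add_comm]
  rw [this, Matrix.charpoly_sub_scalar]
  simp [sub_eq_add_neg]

theorem charpoly_one_add_mul_comm (M N : Matrix T T ℝ) :
    (1 + M * N).charpoly = (1 + N * M).charpoly := by
  rw [charpoly_one_add, charpoly_one_add, Matrix.charpoly_mul_comm]

theorem charpoly_one_add_add_of_mul_eq_zero {U V : Matrix T T ℝ} (h : U * V = 0) :
    (X - C 1) ^ Fintype.card T * (1 + (U + V)).charpoly =
      (1 + U).charpoly * (1 + V).charpoly := by
  simp only [charpoly_one_add, ← mul_comp, ← charpoly_add_of_mul_eq_zero h]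
  simp

/-- The characteristic polynomial of the extension by zero of a square matrix. -/
theorem charpoly_extend {S : Type*} [Fintype S] [DecidableEq S] (I : Matrix T S ℝ)
    (hI : Iᵀ * I = 1) (M : Matrix S S ℝ) :
    X ^ Fintype.card S * (I * M * Iᵀ).charpoly = X ^ Fintype.card T * M.charpoly := by
  have := Matrix.charpoly_mul_comm' I (M * Iᵀ)
  rw [Matrix.mul_assoc, this, Matrix.mul_assoc, hI, Matrix.mul_one]

theorem charpoly_one_add_extend {S : Type*} [Fintype S] [DecidableEq S] (I : Matrix T S ℝ)
    (hI : Iᵀ * I = 1) (M : Matrix S S ℝ) :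
    (X - C 1) ^ Fintype.card S * (1 + I * M * Iᵀ).charpoly =
      (X - C 1) ^ Fintype.card T * (1 + M).charpoly := by
  have := congrArg (fun p : ℝ[X] => p.comp (X - C 1)) (charpoly_extend I hI M)
  simpa [charpoly_one_add] using this

/-- A matrix `Y` supported on `s` can be shifted by the identity of `s` or by the whole
identity matrix; the characteristic polynomials differ in a power of `X` and of `X - 1`. -/
theorem charpoly_diagonal_add (s : T → Prop) [DecidablePred s] (Y : Matrix T T ℝ)
    (hY : Y * Matrix.diagonal (fun x => if s x then 1 else 0) = Y) :
    X ^ (Finset.univ.filter s).card * (X - C 1) ^ Fintype.card T *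
        (Matrix.diagonal (fun x => if s x then 1 else 0) + Y).charpoly =
      X ^ Fintype.card T * (X - C 1) ^ (Finset.univ.filter s).card * (1 + Y).charpoly := by
  set D : Matrix T T ℝ := Matrix.diagonal (fun x => if s x then 1 else 0) with hD
  have hDD : D * D = D := by
    rw [hD, Matrix.diagonal_mul_diagonal]
    congr 1; ext x; split_ifs <;> simp
  -- Since D is idempotent and YD = Y, the matrix 1 + Y is the sum of D + Y and 1 - D, whose product
  -- in this order vanishes.
  have h0 : (D + Y) * (1 - D) = 0 := by
    rw [mul_sub, mul_one, add_mul, hDD, hY, sub_self]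
  have h1 := charpoly_add_of_mul_eq_zero h0
  have h2 : D + Y + (1 - D) = 1 + Y := by abel
  have h3 : (1 - D).charpoly = X ^ (Finset.univ.filter s).card *
      (X - C 1) ^ (Finset.univ.filter fun x => ¬ s x).card := by
    have : (1 - D) = Matrix.diagonal (fun x => if s x then 0 else 1) := by
      rw [hD, ← Matrix.diagonal_one, Matrix.diagonal_sub]
      congr 1; ext x; split_ifs <;> simp
    rw [this, Matrix.charpoly_diagonal]
    have : ∀ x, (X - C (if s x then (0:ℝ) else 1)) = if s x then (X : ℝ[X]) else X - C 1 := by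
      intro x; split_ifs <;> simp
    simp only [this]
    rw [Finset.prod_ite]
    simp
  rw [h2, h3] at h1
  have h4 : Fintype.card T =
      (Finset.univ.filter s).card + (Finset.univ.filter fun x => ¬ s x).card := by
    rw [Finset.card_filter_add_card_filter_not, Finset.card_univ]
  rw [show X ^ Fintype.card T * (X - C 1) ^ (Finset.univ.filter s).card * (1 + Y).charpoly =
    (X - C 1) ^ (Finset.univ.filter s).card * (X ^ Fintype.card T * (1 + Y).charpoly) by ring, h1]
  rw [h4, pow_add]
  ring

end Charpoly

/-! ### Membership in the deletion, contraction and reduction -/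

theorem mem_deletion {Φ : Finset (Finset α)} {e : α} {F : Finset α} :
    F ∈ deletion Φ e ↔ F ∈ Φ ∧ e ∉ F := by
  simp [deletion]

theorem mem_contraction {Φ : Finset (Finset α)} {e : α} {F : Finset α} :
    F ∈ contraction Φ e ↔ e ∉ F ∧ insert e F ∈ Φ := by
  simp only [contraction, Finset.mem_image, Finset.mem_filter]
  constructor
  · rintro ⟨H, ⟨h1, h2⟩, rfl⟩
    exact ⟨Finset.notMem_erase _ _, by rwa [Finset.insert_erase h2]⟩
  · rintro ⟨h1, h2⟩
    exact ⟨insert e F, ⟨h2, Finset.mem_insert_self _ _⟩, Finset.erase_insert h1⟩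

theorem mem_reduction {Φ : Finset (Finset α)} {e : α} {F : Finset α} :
    F ∈ reduction Φ e ↔ F ∈ Φ ∧ (e ∉ F → insert e F ∉ Φ) ∧ (e ∈ F → F.erase e ∉ Φ) := by
  simp only [reduction, starOf, Finset.mem_sdiff, Finset.mem_biUnion, Finset.mem_filter,
    Finset.mem_insert, Finset.mem_singleton]
  refine and_congr_right fun hF => ?_
  constructor
  · intro h
    refine ⟨fun he h' => h ⟨F, ⟨hF, he, h'⟩, Or.inl rfl⟩, fun he h' => h ⟨F.erase e, ⟨h', ?_, ?_⟩, ?_⟩⟩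
    · exact Finset.notMem_erase _ _
    · rwa [Finset.insert_erase he]
    · exact Or.inr (Finset.insert_erase he).symm
  · rintro ⟨h1, h2⟩ ⟨G, ⟨hG, he, hG'⟩, rfl | rfl⟩
    · exact h1 he hG'
    · exact h2 (Finset.mem_insert_self _ _) (by rwa [Finset.erase_insert he])

/-! ### Intervals of near-cones -/

/-- `Δ` is a near-cone with apex `a`: a vertex of a face can be replaced by `a`. -/
structure IsNearCone (E : Finset α) (a : α) (Δ : Finset (Finset α)) : Prop where
  isComplex : IsComplex E Δ
  replace : ∀ H ∈ Δ, ∀ v ∈ H, insert a (H.erase v) ∈ Δ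

/-- A relative pair of near-cones with the same apex. -/
def IsNearConeInterval (E : Finset α) (a : α) (Φ : Finset (Finset α)) : Prop :=
  ∃ Δ Δ' : Finset (Finset α), IsNearCone E a Δ ∧ IsNearCone E a Δ' ∧ Δ' ⊆ Δ ∧ Φ = Δ \ Δ'

namespace IsNearConeInterval

variable {E : Finset α} {a : α} {Φ : Finset (Finset α)}

theorem subset (h : IsNearConeInterval E a Φ) {F : Finset α} (hF : F ∈ Φ) : F ⊆ E := by
  obtain ⟨Δ, Δ', h1, -, -, rfl⟩ := h
  exact h1.isComplex.1 F (Finset.mem_sdiff.1 hF).1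

theorem convex (h : IsNearConeInterval E a Φ) {G H F : Finset α} (hG : G ∈ Φ) (hF : F ∈ Φ)
    (hGH : G ⊆ H) (hHF : H ⊆ F) : H ∈ Φ := by
  obtain ⟨Δ, Δ', h1, h2, -, rfl⟩ := h
  rw [Finset.mem_sdiff] at *
  exact ⟨h1.isComplex.2 H F hHF hF.1, fun h' => hG.2 (h2.isComplex.2 G H hGH h')⟩

/-- Replacing v by a stays in Δ, and a superset of a set outside Δ' is outside Δ'. Hence the faces
hit by the boundary of Φ-a are bases of pairs in the star of a. -/
theorem insert_erase_mem (h : IsNearConeInterval E a Φ) {F : Finset α} {v : α} (hF : F ∈ Φ)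
    (hv : v ∈ F) (hFv : F.erase v ∈ Φ) : insert a (F.erase v) ∈ Φ := by
  obtain ⟨Δ, Δ', h1, h2, -, rfl⟩ := h
  rw [Finset.mem_sdiff] at *
  exact ⟨h1.replace F hF.1 v hv,
    fun h' => hFv.2 (h2.isComplex.2 _ _ (Finset.subset_insert _ _) h')⟩

/-- The dual statement: if F \ a were in Δ', replacing v by a would put F \ v in Δ'. -/
theorem erase_mem (h : IsNearConeInterval E a Φ) {F : Finset α} {v : α} (hF : F ∈ Φ)
    (ha : a ∈ F) (hv : v ∈ F) (hFv : F.erase v ∈ Φ) : F.erase a ∈ Φ := by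
  obtain ⟨Δ, Δ', h1, h2, -, rfl⟩ := h
  by_cases hva : v = a
  · rwa [hva] at hFv
  rw [Finset.mem_sdiff] at *
  refine ⟨h1.isComplex.2 _ _ (Finset.erase_subset _ _) hF.1, fun h' => hFv.2 ?_⟩
  have := h2.replace _ h' v (Finset.mem_erase.2 ⟨hva, hv⟩)
  rwa [Finset.erase_right_comm, Finset.insert_erase (Finset.mem_erase.2 ⟨Ne.symm hva, ha⟩)] at this

/-- Replacing a vertex of F \ H by a shows a ∪ H ∈ Δ; replacing a vertex of H \ G by a shows H ∉ Δ',
as otherwise a ∪ G ∈ Δ'. This supplies the intermediate faces needed for DA = 0. -/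
theorem between (h : IsNearConeInterval E a Φ) {G H F : Finset α} (hF : F ∈ Φ)
    (hG : insert a G ∈ Φ) (hGH : G ⊂ H) (hHF : H ⊂ F) : H ∈ Φ ∧ insert a H ∈ Φ := by
  obtain ⟨Δ, Δ', h1, h2, -, rfl⟩ := h
  obtain ⟨v, hv, hv'⟩ := Finset.exists_of_ssubset hHF
  obtain ⟨w, hw, hw'⟩ := Finset.exists_of_ssubset hGH
  rw [Finset.mem_sdiff] at *
  have key : insert a H ∈ Δ := by
    refine h1.isComplex.2 _ _ (Finset.insert_subset_insert a ?_) (h1.replace F hF.1 v hv)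
    exact Finset.subset_erase.2 ⟨hHF.1, hv'⟩
  have key' : H ∉ Δ' := fun h' => hG.2 <| by
    refine h2.isComplex.2 _ _ (Finset.insert_subset_insert a ?_) (h2.replace H h' w hw)
    exact Finset.subset_erase.2 ⟨hGH.1, hw'⟩
  refine ⟨⟨h1.isComplex.2 _ _ hHF.1 hF.1, key'⟩, Finset.mem_sdiff.2 ⟨key, fun h' => key' ?_⟩⟩
  exact h2.isComplex.2 _ _ (Finset.subset_insert _ _) h'

end IsNearConeInterval

/-! ### Boundary operators extended by zero to all subsets of the ground set -/

open Matrix Polynomial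

/-- The subsets of `E`, as an index type. -/
abbrev Subsets (E : Finset α) : Type _ := {F : Finset α // F ∈ E.powerset}

/-- The boundary operator from the `i`-chains of `Φ`, extended by zero. -/
def extBoundary (E : Finset α) (Φ : Finset (Finset α)) (i : ℤ) :
    Matrix (Subsets E) (Subsets E) ℝ :=
  Matrix.of fun G F =>
    if G.1 ∈ Φ ∧ F.1 ∈ Φ ∧ (F.1.card : ℤ) - 1 = i then incidence G.1 F.1 else 0

/-- The inclusion of the `i`-chains of `Φ`. -/
def facesInclusion (E : Finset α) (Φ : Finset (Finset α)) (i : ℤ) :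
    Matrix (Subsets E) (Faces Φ i) ℝ :=
  Matrix.of fun F G => if F.1 = G.1 then 1 else 0

/-- The Laplacian extended by zero. -/
def extLaplacian (E : Finset α) (Φ : Finset (Finset α)) (i : ℤ) :
    Matrix (Subsets E) (Subsets E) ℝ :=
  extBoundary E Φ (i + 1) * (extBoundary E Φ (i + 1))ᵀ +
    (extBoundary E Φ i)ᵀ * extBoundary E Φ i

theorem card_of_incidence_ne_zero {G F : Finset α} (h : incidence G F ≠ 0) :
    (G.card : ℤ) = F.card - 1 := by
  obtain ⟨v, hv, rfl⟩ := exists_of_incidence_ne_zero h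
  have := Finset.card_erase_add_one hv
  omega

theorem facesInclusion_transpose_mul {E : Finset α} {Φ : Finset (Finset α)}
    (hE : ∀ F ∈ Φ, F ⊆ E) (i : ℤ) :
    (facesInclusion E Φ i)ᵀ * facesInclusion E Φ i = 1 := by
  ext G F
  have hG : G.1 ∈ E.powerset := Finset.mem_powerset.2 (hE _ (Finset.mem_filter.1 G.2).1)
  rw [Matrix.mul_apply, Finset.sum_eq_single_of_mem (⟨G.1, hG⟩ : Subsets E) (Finset.mem_univ _)]
  · simp only [facesInclusion, Matrix.transpose_apply, Matrix.of_apply, if_true, one_mul,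
      Matrix.one_apply]
    exact if_congr Subtype.ext_iff.symm rfl rfl
  · intro H _ hH
    have : H.1 ≠ G.1 := fun h => hH (Subtype.ext h)
    simp [facesInclusion, this]

theorem facesInclusion_mul_apply {E : Finset α} {Φ : Finset (Finset α)} {i : ℤ} {β : Type*}
    (M : Matrix (Faces Φ i) β ℝ) (G : Subsets E) (b : β) :
    (facesInclusion E Φ i * M) G b =
      if h : G.1 ∈ Φ.filter (fun F => (F.card : ℤ) - 1 = i) then M ⟨G.1, h⟩ b else 0 := by
  rw [Matrix.mul_apply]
  split_ifs with h
  · rw [Finset.sum_eq_single_of_mem (⟨G.1, h⟩ : Faces Φ i) (Finset.mem_univ _)]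
    · simp [facesInclusion]
    · intro H _ hH
      have : G.1 ≠ H.1 := fun h => hH (Subtype.ext h.symm)
      simp [facesInclusion, this]
  · refine Finset.sum_eq_zero fun H _ => ?_
    have : G.1 ≠ H.1 := fun h' => h (h' ▸ H.2)
    simp [facesInclusion, this]

theorem extBoundary_eq {E : Finset α} {Φ : Finset (Finset α)} {i j : ℤ} (hj : j = i - 1) :
    extBoundary E Φ i = facesInclusion E Φ j * boundary Φ j i * (facesInclusion E Φ i)ᵀ := by
  ext G F
  rw [Matrix.mul_assoc, facesInclusion_mul_apply]
  have h2 : ∀ G', (boundary Φ j i * (facesInclusion E Φ i)ᵀ) G' F =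
      if h : F.1 ∈ Φ.filter (fun F => (F.card : ℤ) - 1 = i) then boundary Φ j i G' ⟨F.1, h⟩
      else 0 := by
    intro G'
    have := facesInclusion_mul_apply (boundary Φ j i)ᵀ F G'
    rw [← Matrix.transpose_apply (M := boundary Φ j i * _), Matrix.transpose_mul,
      Matrix.transpose_transpose, this]
    rfl
  simp only [h2]
  simp only [extBoundary, boundary, Matrix.of_apply, Finset.mem_filter]
  by_cases h0 : incidence G.1 F.1 = 0
  · simp [h0]
  · have hc := card_of_incidence_ne_zero h0
    by_cases hG : G.1 ∈ Φ <;> by_cases hF : F.1 ∈ Φ <;> by_cases hi : (F.1.card : ℤ) - 1 = i <;>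
      simp [hG, hF, hi]
    omega

theorem extLaplacian_eq {E : Finset α} {Φ : Finset (Finset α)} (hE : ∀ F ∈ Φ, F ⊆ E) (i : ℤ) :
    extLaplacian E Φ i = facesInclusion E Φ i * laplacian Φ i * (facesInclusion E Φ i)ᵀ := by
  rw [extLaplacian, extBoundary_eq (i := i + 1) (j := i) (by ring),
    extBoundary_eq (i := i) (j := i - 1) rfl, laplacian]
  have key : ∀ (j : ℤ) (M : Matrix (Faces Φ j) (Subsets E) ℝ),
      (facesInclusion E Φ j)ᵀ * (facesInclusion E Φ j * M) = M := fun j M => by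
    rw [← Matrix.mul_assoc, facesInclusion_transpose_mul hE, Matrix.one_mul]
  simp only [Matrix.transpose_mul, Matrix.transpose_transpose, Matrix.mul_add, Matrix.add_mul,
    Matrix.mul_assoc, key]

/-- The number of faces of dimension `i`. -/
def faceNumber (Φ : Finset (Finset α)) (i : ℤ) : ℕ :=
  (Φ.filter fun F => (F.card : ℤ) - 1 = i).card

theorem card_faces {α : Type*} (Φ : Finset (Finset α)) (i : ℤ) :
    Fintype.card (Faces Φ i) = faceNumber Φ i :=
  Fintype.card_coe _

/-- Extension by zero only adds eigenvalues 0. -/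
theorem charpoly_extLaplacian {E : Finset α} {Φ : Finset (Finset α)} (hE : ∀ F ∈ Φ, F ⊆ E)
    (i : ℤ) : X ^ faceNumber Φ i * (extLaplacian E Φ i).charpoly =
      X ^ Fintype.card (Subsets E) * (laplacian Φ i).charpoly := by
  rw [extLaplacian_eq hE, ← card_faces]
  exact charpoly_extend _ (facesInclusion_transpose_mul hE i) _

/-- After adding the identity, the padding contributes eigenvalues 1. -/
theorem charpoly_one_add_extLaplacian {E : Finset α} {Φ : Finset (Finset α)}
    (hE : ∀ F ∈ Φ, F ⊆ E) (i : ℤ) :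
    (X - C 1) ^ faceNumber Φ i * (1 + extLaplacian E Φ i).charpoly =
      (X - C 1) ^ Fintype.card (Subsets E) * (1 + laplacian Φ i).charpoly := by
  rw [extLaplacian_eq hE, ← card_faces]
  exact charpoly_one_add_extend _ (facesInclusion_transpose_mul hE i) _

/-- The cancellation in ∂∂ = 0 needs every intermediate face to be present in both families.
Allowing two families covers Φ/a against Φ-a as well as a single interval. -/
theorem extBoundary_mul_extBoundary {E : Finset α} {Φ Ψ : Finset (Finset α)}
    (h : ∀ G ∈ Φ, ∀ F ∈ Ψ, ∀ H, G ⊂ H → H ⊂ F → H ∈ Φ ∧ H ∈ Ψ) (i : ℤ) :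
    extBoundary E Φ i * extBoundary E Ψ (i + 1) = 0 := by
  ext G F
  rw [Matrix.mul_apply, Matrix.zero_apply]
  by_cases hh : G.1 ∈ Φ ∧ F.1 ∈ Ψ ∧ (F.1.card : ℤ) - 1 = i + 1
  · obtain ⟨hG, hF, hi⟩ := hh
    rw [← sum_incidence_mul_incidence (Finset.mem_powerset.1 F.2) G.1,
      ← Finset.sum_coe_sort E.powerset]
    refine Finset.sum_congr rfl fun H _ => ?_
    by_cases h1 : incidence G.1 H.1 = 0
    · simp [extBoundary, h1]
    by_cases h2 : incidence H.1 F.1 = 0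
    · simp [extBoundary, h2]
    have hc := card_of_incidence_ne_zero h2
    obtain ⟨v, hv, hv'⟩ := exists_of_incidence_ne_zero h1
    obtain ⟨w, hw, hw'⟩ := exists_of_incidence_ne_zero h2
    obtain ⟨h3, h4⟩ := h _ hG _ hF H.1 (hv' ▸ Finset.erase_ssubset hv)
      (hw' ▸ Finset.erase_ssubset hw)
    have h5 : (H.1.card : ℤ) - 1 = i := by omega
    simp [extBoundary, hG, hF, hi, h3, h4, h5]
  · refine Finset.sum_eq_zero fun H _ => ?_
    simp only [extBoundary, Matrix.of_apply]
    by_cases hG : G.1 ∈ Φ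
    · rw [if_neg (c := H.1 ∈ Ψ ∧ _), mul_zero]
      rintro ⟨-, h1, h2⟩
      exact hh ⟨hG, h1, h2⟩
    · rw [if_neg (c := G.1 ∈ Φ ∧ _), zero_mul]
      exact fun h' => hG h'.1

/-! ### The characteristic polynomials for an interval of near-cones -/

section Algebra

variable {T : Type*} [Fintype T] [DecidableEq T]

theorem charpoly_mul_mul_transpose (P Q : Matrix T T ℝ) :
    ((P * Q) * (P * Q)ᵀ).charpoly = (Pᵀ * P * (Q * Qᵀ)).charpoly := by
  rw [Matrix.transpose_mul, show P * Q * (Qᵀ * Pᵀ) = (P * (Q * Qᵀ)) * Pᵀ by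
    simp only [Matrix.mul_assoc], Matrix.charpoly_mul_comm, Matrix.mul_assoc]

theorem charpoly_transpose_mul_mul (P Q : Matrix T T ℝ) :
    ((P * Q)ᵀ * (P * Q)).charpoly = (Pᵀ * P * (Q * Qᵀ)).charpoly := by
  rw [Matrix.charpoly_mul_comm, charpoly_mul_mul_transpose]

theorem mul_transpose_mul_transpose_mul {M N : Matrix T T ℝ} (h : M * N = 0) :
    N * Nᵀ * (Mᵀ * M) = 0 := by
  have : Nᵀ * Mᵀ = 0 := by rw [← Matrix.transpose_mul, h, Matrix.transpose_zero]
  rw [show N * Nᵀ * (Mᵀ * M) = N * (Nᵀ * Mᵀ) * M by simp only [Matrix.mul_assoc], this]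
  simp

/-- Factorization of the boundary of an interval of near-cones, in abstract form: `p` is the
projection to the base of the star, `J` the cone operator, `A` and `D` are the boundaries of
the deletion and the contraction. -/
theorem cone_factorization {p J A D : Matrix T T ℝ} (hpt : pᵀ = p) (hpp : p * p = p)
    (hpA : p * A = A) (hDp : D * p = D) (hDA : D * A = 0) (hJD : Jᵀ * J * D = D)
    (hpJ : p * J = 0) (hAJ : A * J = 0) (hpJJ : p * (Jᵀ * J) = p) :
    ∃ P Q : Matrix T T ℝ, P * Q = A + p * Jᵀ - J * D * Jᵀ ∧
      Pᵀ * P * (Q * Qᵀ) = p + (A * Aᵀ + Dᵀ * D) := by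
  have hJp : Jᵀ * p = 0 := by
    rw [← hpt, ← Matrix.transpose_mul, hpJ, Matrix.transpose_zero]
  have hJA : Jᵀ * Aᵀ = 0 := by rw [← Matrix.transpose_mul, hAJ, Matrix.transpose_zero]
  -- Q sends x + a*σ to ∂x + pσ, a chain on the base of the star; P sends a base chain τ to τ -
  -- a*∂τ, the boundary of its cone.
  refine ⟨p - J * D, A + p * Jᵀ, ?_, ?_⟩
  · rw [Matrix.sub_mul, Matrix.mul_add, Matrix.mul_add, hpA, ← Matrix.mul_assoc p p, hpp,
      Matrix.mul_assoc J D A, hDA, Matrix.mul_zero, zero_add, ← Matrix.mul_assoc (J * D) p,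
      Matrix.mul_assoc J D p, hDp]
  · have h1 : (p - J * D)ᵀ * (p - J * D) = p + Dᵀ * D := by
      rw [Matrix.transpose_sub, Matrix.transpose_mul, hpt, Matrix.sub_mul, Matrix.mul_sub,
        Matrix.mul_sub, hpp, ← Matrix.mul_assoc p J D, hpJ, Matrix.mul_assoc Dᵀ Jᵀ p, hJp,
        Matrix.mul_assoc Dᵀ Jᵀ, ← Matrix.mul_assoc Jᵀ J D, hJD]
      simp
    have h2 : (A + p * Jᵀ) * (A + p * Jᵀ)ᵀ = A * Aᵀ + p := by
      rw [Matrix.transpose_add, Matrix.transpose_mul, hpt, Matrix.transpose_transpose,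
        Matrix.add_mul, Matrix.mul_add, Matrix.mul_add, ← Matrix.mul_assoc A J p, hAJ,
        Matrix.mul_assoc p Jᵀ Aᵀ, hJA, show p * Jᵀ * (J * p) = (p * (Jᵀ * J)) * p by
          simp only [Matrix.mul_assoc], hpJJ, hpp]
      simp
    rw [h1, h2, Matrix.add_mul, Matrix.mul_add, Matrix.mul_add, hpp, ← Matrix.mul_assoc p A, hpA,
      Matrix.mul_assoc Dᵀ D p, hDp, Matrix.mul_assoc Dᵀ D, ← Matrix.mul_assoc D A, hDA]
    simp only [Matrix.zero_mul, Matrix.mul_zero]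
    abel

end Algebra

/-- The projection to the `i`-chains of `Φ`. -/
def facesProjection (E : Finset α) (Φ : Finset (Finset α)) (i : ℤ) :
    Matrix (Subsets E) (Subsets E) ℝ :=
  Matrix.diagonal fun F => if F.1 ∈ Φ ∧ (F.1.card : ℤ) - 1 = i then 1 else 0

/-- The cone operator with apex `a`. -/
def coneMatrix (E : Finset α) (a : α) : Matrix (Subsets E) (Subsets E) ℝ :=
  Matrix.of fun G F => if a ∉ F.1 ∧ G.1 = insert a F.1 then 1 else 0

theorem faceNumber_eq_card_filter {E : Finset α} {Φ : Finset (Finset α)} (hE : ∀ F ∈ Φ, F ⊆ E)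
    (i : ℤ) : (Finset.univ.filter fun F : Subsets E =>
      F.1 ∈ Φ ∧ (F.1.card : ℤ) - 1 = i).card = faceNumber Φ i := by
  rw [faceNumber, ← Finset.card_map (Function.Embedding.subtype _)]
  congr 1
  ext F
  simp only [Finset.mem_map, Finset.mem_filter, Finset.mem_univ, true_and,
    Function.Embedding.subtype_apply]
  constructor
  · rintro ⟨G, h, rfl⟩; exact h
  · intro h; exact ⟨⟨F, Finset.mem_powerset.2 (hE F h.1)⟩, h, rfl⟩

/-- The base of the star of `a`. -/
def starBase (Φ : Finset (Finset α)) (a : α) : Finset (Finset α) :=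
  deletion Φ a ∩ contraction Φ a

theorem mem_starBase {Φ : Finset (Finset α)} {a : α} {F : Finset α} :
    F ∈ starBase Φ a ↔ a ∉ F ∧ F ∈ Φ ∧ insert a F ∈ Φ := by
  rw [starBase, Finset.mem_inter, mem_deletion, mem_contraction]
  tauto

/-! ### The cone operator and the factored boundary of a near-cone interval -/

section NearCone

variable {E : Finset α} {a : α} {Φ : Finset (Finset α)}

theorem mul_coneMatrix_apply (haE : a ∈ E) (M : Matrix (Subsets E) (Subsets E) ℝ)
    (G F : Subsets E) : (M * coneMatrix E a) G F = if a ∉ F.1 then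
      M G ⟨insert a F.1, Finset.mem_powerset.2
        (Finset.insert_subset haE (Finset.mem_powerset.1 F.2))⟩ else 0 := by
  rw [Matrix.mul_apply, Finset.sum_eq_single_of_mem (⟨insert a F.1, Finset.mem_powerset.2
        (Finset.insert_subset haE (Finset.mem_powerset.1 F.2))⟩ : Subsets E) (Finset.mem_univ _)]
  · simp [coneMatrix]
  · intro H _ hH
    have : H.1 ≠ insert a F.1 := fun h => hH (Subtype.ext h)
    simp [coneMatrix, this]

theorem coneMatrix_mul_apply (M : Matrix (Subsets E) (Subsets E) ℝ)
    (G F : Subsets E) : (coneMatrix E a * M) G F = if a ∈ G.1 then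
      M ⟨G.1.erase a, Finset.mem_powerset.2
        ((Finset.erase_subset _ _).trans (Finset.mem_powerset.1 G.2))⟩ F else 0 := by
  rw [Matrix.mul_apply, Finset.sum_eq_single_of_mem (⟨G.1.erase a, Finset.mem_powerset.2
        ((Finset.erase_subset _ _).trans (Finset.mem_powerset.1 G.2))⟩ : Subsets E)
        (Finset.mem_univ _)]
  · by_cases h : a ∈ G.1
    · simp [coneMatrix, h, Finset.insert_erase h]
    · have : G.1 ≠ insert a G.1 := fun h' => h (h' ▸ Finset.mem_insert_self _ _)
      simp [coneMatrix, h, this]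
  · intro H _ hH
    have : ¬ (a ∉ H.1 ∧ G.1 = insert a H.1) := by
      rintro ⟨h1, h2⟩
      refine hH (Subtype.ext ?_)
      simp only [h2, Finset.erase_insert h1]
    simp only [coneMatrix, Matrix.of_apply, if_neg this, zero_mul]

theorem mul_coneMatrix_transpose_apply (M : Matrix (Subsets E) (Subsets E) ℝ)
    (G F : Subsets E) : (M * (coneMatrix E a)ᵀ) G F = if a ∈ F.1 then
      M G ⟨F.1.erase a, Finset.mem_powerset.2
        ((Finset.erase_subset _ _).trans (Finset.mem_powerset.1 F.2))⟩ else 0 := by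
  rw [← Matrix.transpose_apply (M := M * _), Matrix.transpose_mul, Matrix.transpose_transpose,
    coneMatrix_mul_apply]
  rfl

theorem coneMatrix_transpose_mul_self (haE : a ∈ E) :
    (coneMatrix E a)ᵀ * coneMatrix E a =
      Matrix.diagonal fun F : Subsets E => if a ∉ F.1 then 1 else 0 := by
  ext G F
  rw [mul_coneMatrix_apply haE, Matrix.diagonal_apply]
  by_cases hF : a ∈ F.1
  · by_cases hGF : G = F
    · subst hGF; simp [hF]
    · simp [hF, hGF]
  · simp only [hF, not_false_eq_true, if_true, Matrix.transpose_apply, coneMatrix, Matrix.of_apply]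
    by_cases hGF : G = F
    · subst hGF; simp [hF]
    · rw [if_neg hGF, if_neg]
      rintro ⟨h1, h2⟩
      have := congrArg (fun s => Finset.erase s a) h2
      simp only [Finset.erase_insert hF, Finset.erase_insert h1] at this
      exact hGF (Subtype.ext this.symm)

/-- Block form according to whether G and F contain a. Minimality of a fixes the signs: +1 when F =
a ∪ G, and -1 times the incidence of the contraction when both contain a. -/
theorem extBoundary_eq_add (hmin : ∀ x ∈ E, a ≤ x) (i : ℤ) :
    extBoundary E Φ i = extBoundary E (deletion Φ a) i +
      facesProjection E (starBase Φ a) (i - 1) * (coneMatrix E a)ᵀ -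
      coneMatrix E a * extBoundary E (contraction Φ a) (i - 1) * (coneMatrix E a)ᵀ := by
  ext G F
  have hlt' : ∀ x ∈ F.1.erase a, a < x := fun x hx =>
    lt_of_le_of_ne (hmin x (Finset.mem_powerset.1 F.2 (Finset.mem_of_mem_erase hx)))
      (Finset.ne_of_mem_erase hx).symm
  rw [Matrix.sub_apply, Matrix.add_apply, mul_coneMatrix_transpose_apply,
    mul_coneMatrix_transpose_apply, coneMatrix_mul_apply]
  by_cases hF : a ∈ F.1
  · have hcard := Finset.card_erase_add_one hF
    have hcard' : (((F.1.card - 1 : ℕ) : ℤ) = i) ↔ ((F.1.card : ℤ) - 1 = i) := by omega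
    by_cases hG : a ∈ G.1
    · have hne : G.1 ≠ F.1.erase a := fun h => Finset.notMem_erase a F.1 (h ▸ hG)
      have hinc := incidence_insert_insert hlt' (Finset.notMem_erase a G.1)
      rw [Finset.insert_erase hF, Finset.insert_erase hG] at hinc
      simp [extBoundary, mem_deletion, mem_contraction, facesProjection,
        Subtype.ext_iff, hF, hG, hne, Finset.insert_erase, hcard', hinc]
      split_ifs <;> simp
    · by_cases hGF : G.1 = F.1.erase a
      · have hinc := incidence_insert_self hlt'
        rw [Finset.insert_erase hF] at hinc
        simp [extBoundary, mem_deletion, mem_starBase, facesProjection, Matrix.diagonal_apply,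
          Subtype.ext_iff, hF, hGF, Finset.insert_erase, hcard', hinc, and_assoc]
      · have hinc : incidence G.1 F.1 = 0 := by
          refine incidence_eq_zero fun v hv h => ?_
          by_cases hva : v = a
          · exact hGF (by rw [← h, hva])
          · exact hG (h ▸ Finset.mem_erase.2 ⟨Ne.symm hva, hF⟩)
        simp [extBoundary, mem_deletion, facesProjection,
          Subtype.ext_iff, hF, hG, hGF, hinc]
  · by_cases hG : a ∈ G.1
    · have hinc : incidence G.1 F.1 = 0 :=
        incidence_eq_zero fun v hv h => hF (Finset.mem_of_mem_erase (h ▸ hG))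
      simp [extBoundary, hF, hinc]
    · simp [extBoundary, mem_deletion, hF, hG]

/-- By `insert_erase_mem`, the image of A is supported on the base of the star. -/
theorem IsNearConeInterval.projection_mul (h : IsNearConeInterval E a Φ) (i : ℤ) :
    facesProjection E (starBase Φ a) (i - 1) * extBoundary E (deletion Φ a) i =
      extBoundary E (deletion Φ a) i := by
  ext G F
  rw [facesProjection, Matrix.diagonal_mul]
  simp only [extBoundary, Matrix.of_apply, mem_deletion, mem_starBase]
  by_cases hinc : incidence G.1 F.1 = 0
  · simp [hinc]
  split_ifs with h1 h2
  · simp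
  · simp
  · exfalso
    apply h1
    rename_i h2
    obtain ⟨hG, hF, hi⟩ := h2
    have hc := card_of_incidence_ne_zero hinc
    obtain ⟨v, hv, hv'⟩ := exists_of_incidence_ne_zero hinc
    refine ⟨⟨hG.2, hG.1, ?_⟩, by omega⟩
    rw [← hv'] at hG ⊢
    exact h.insert_erase_mem hF.1 hv hG.1
  · simp

/-- By `erase_mem`, D vanishes on faces outside the base of the star. -/
theorem IsNearConeInterval.mul_projection (h : IsNearConeInterval E a Φ) (i : ℤ) :
    extBoundary E (contraction Φ a) i * facesProjection E (starBase Φ a) i =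
      extBoundary E (contraction Φ a) i := by
  ext G F
  rw [facesProjection, Matrix.mul_diagonal]
  simp only [extBoundary, Matrix.of_apply, mem_contraction, mem_starBase]
  by_cases hinc : incidence G.1 F.1 = 0
  · simp [hinc]
  split_ifs with h1 h2 h2
  · simp
  · exfalso
    apply h2
    obtain ⟨hG, hF, hi⟩ := h1
    obtain ⟨v, hv, hv'⟩ := exists_of_incidence_ne_zero hinc
    refine ⟨⟨hF.1, ?_, hF.2⟩, hi⟩
    have hav : a ≠ v := fun h => hF.1 (h ▸ hv)
    have := h.erase_mem hF.2 (Finset.mem_insert_self _ _) (Finset.mem_insert_of_mem hv)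
      (by rw [Finset.erase_insert_of_ne hav, hv']; exact hG.2)
    rwa [Finset.erase_insert hF.1] at this
  · simp
  · simp

/-- W is the characteristic polynomial of p + AAᵀ + DᵀD from the factorization. The powers of X and
X - 1 come from replacing p by the full identity. -/
theorem IsNearConeInterval.charpoly_boundary (h : IsNearConeInterval E a Φ) (haE : a ∈ E)
    (hmin : ∀ x ∈ E, a ≤ x) (i : ℤ) :
    ∃ W : ℝ[X], (extBoundary E Φ i * (extBoundary E Φ i)ᵀ).charpoly = W ∧
      ((extBoundary E Φ i)ᵀ * extBoundary E Φ i).charpoly = W ∧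
      X ^ faceNumber (starBase Φ a) (i - 1) * (X - C 1) ^ (2 * Fintype.card (Subsets E)) * W =
        X ^ Fintype.card (Subsets E) * (X - C 1) ^ faceNumber (starBase Φ a) (i - 1) *
          ((1 + extBoundary E (deletion Φ a) i * (extBoundary E (deletion Φ a) i)ᵀ).charpoly *
          (1 + (extBoundary E (contraction Φ a) (i - 1))ᵀ *
            extBoundary E (contraction Φ a) (i - 1)).charpoly) := by
  set A := extBoundary E (deletion Φ a) i with hA
  set D := extBoundary E (contraction Φ a) (i - 1) with hD
  set p := facesProjection E (starBase Φ a) (i - 1) with hp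
  set J := coneMatrix E a with hJ
  have hpA : p * A = A := h.projection_mul i
  have hDp : D * p = D := h.mul_projection (i - 1)
  have hDA : D * A = 0 := by
    have := extBoundary_mul_extBoundary (E := E) (Φ := contraction Φ a) (Ψ := deletion Φ a)
      (fun G hG F hF H hGH hHF => by
        rw [mem_contraction] at hG ⊢
        rw [mem_deletion] at hF ⊢
        have haH : a ∉ H := fun h' => hF.2 (hHF.1 h')
        have := h.between hF.1 hG.2 hGH hHF
        exact ⟨⟨haH, this.2⟩, this.1, haH⟩) (i - 1)
    rwa [sub_add_cancel] at this
  have hDA' := mul_transpose_mul_transpose_mul hDA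
  have hpt : pᵀ = p := Matrix.diagonal_transpose _
  have hpp : p * p = p := by
    rw [hp, facesProjection, Matrix.diagonal_mul_diagonal]
    congr 1; ext F; split_ifs <;> simp
  have hJJ : Jᵀ * J = _ := coneMatrix_transpose_mul_self haE
  obtain ⟨P, Q, hPQ, hW⟩ := cone_factorization (J := J) hpt hpp hpA hDp hDA
    (by
      ext G F
      rw [hJJ, Matrix.diagonal_mul]
      by_cases hG : a ∈ G.1 <;> simp [hD, extBoundary, mem_contraction, hG])
    (by
      ext G F
      rw [hp, facesProjection, Matrix.diagonal_mul, hJ, coneMatrix, Matrix.of_apply]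
      by_cases hG : a ∈ G.1
      · simp [mem_starBase, hG]
      · have : G.1 ≠ insert a F.1 := fun h' => hG (h' ▸ Finset.mem_insert_self _ _)
        simp [this])
    (by
      ext G F
      rw [hJ, mul_coneMatrix_apply haE]
      simp [hA, extBoundary, mem_deletion])
    (by
      rw [hJJ, hp, facesProjection, Matrix.diagonal_mul_diagonal]
      congr 1; ext F
      by_cases hF : a ∈ F.1 <;> simp [mem_starBase, hF])
  have hbd : extBoundary E Φ i = P * Q := by rw [hPQ]; exact extBoundary_eq_add hmin i
  refine ⟨(p + (A * Aᵀ + Dᵀ * D)).charpoly, ?_, ?_, ?_⟩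
  · rw [hbd, charpoly_mul_mul_transpose, hW]
  · rw [hbd, charpoly_transpose_mul_mul, hW]
  · rw [← charpoly_one_add_add_of_mul_eq_zero hDA']
    have hsub : ∀ F ∈ starBase Φ a, F ⊆ E := fun F hF => h.subset (mem_starBase.1 hF).2.1
    have hAp : Aᵀ * p = Aᵀ := by
      rw [← hpt, ← Matrix.transpose_mul, hpA]
    have := charpoly_diagonal_add (fun F : Subsets E => F.1 ∈ starBase Φ a ∧
      (F.1.card : ℤ) - 1 = i - 1) (A * Aᵀ + Dᵀ * D) (by
        change _ * p = _
        rw [Matrix.add_mul, Matrix.mul_assoc, hAp, Matrix.mul_assoc, hDp])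
    rw [faceNumber_eq_card_filter hsub] at this
    change _ * (p + _).charpoly = _ at this
    -- One factor (X - 1)^N splits 1 + AAᵀ + DᵀD into its two summands; the other comes from
    -- `charpoly_diagonal_add`.
    rw [pow_mul', sq]
    linear_combination (X - C 1) ^ Fintype.card (Subsets E) * this

end NearCone

/-- ∂∂ = 0 makes the upper and lower parts of the Laplacian annihilate each other, so their
characteristic polynomials multiply. -/
theorem charpoly_one_add_extLaplacian_eq_mul {E : Finset α} {Φ : Finset (Finset α)}
    (h : ∀ G ∈ Φ, ∀ F ∈ Φ, ∀ H, G ⊂ H → H ⊂ F → H ∈ Φ) (i : ℤ) :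
    (X - C 1) ^ Fintype.card (Subsets E) * (1 + extLaplacian E Φ i).charpoly =
      (1 + extBoundary E Φ (i + 1) * (extBoundary E Φ (i + 1))ᵀ).charpoly *
        (1 + (extBoundary E Φ i)ᵀ * extBoundary E Φ i).charpoly :=
  charpoly_one_add_add_of_mul_eq_zero <| mul_transpose_mul_transpose_mul <|
    extBoundary_mul_extBoundary (fun G hG F hF H h1 h2 =>
      ⟨h G hG F hF H h1 h2, h G hG F hF H h1 h2⟩) i

theorem charpoly_extLaplacian_eq_mul {E : Finset α} {Φ : Finset (Finset α)}
    (h : ∀ G ∈ Φ, ∀ F ∈ Φ, ∀ H, G ⊂ H → H ⊂ F → H ∈ Φ) (i : ℤ) :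
    X ^ Fintype.card (Subsets E) * (extLaplacian E Φ i).charpoly =
      (extBoundary E Φ (i + 1) * (extBoundary E Φ (i + 1))ᵀ).charpoly *
        ((extBoundary E Φ i)ᵀ * extBoundary E Φ i).charpoly :=
  charpoly_add_of_mul_eq_zero <| mul_transpose_mul_transpose_mul <|
    extBoundary_mul_extBoundary (fun G hG F hF H h1 h2 =>
      ⟨h G hG F hF H h1 h2, h G hG F hF H h1 h2⟩) i

/-! ### Face numbers -/

theorem faceNumber_eq_add (Φ : Finset (Finset α)) (a : α) (i : ℤ) :
    faceNumber Φ i = faceNumber (deletion Φ a) i + faceNumber (contraction Φ a) (i - 1) := by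
  have h1 : faceNumber (contraction Φ a) (i - 1) =
      ((Φ.filter fun F => (F.card : ℤ) - 1 = i).filter fun F => ¬ a ∉ F).card := by
    rw [faceNumber]
    refine Finset.card_bij' (fun F _ => insert a F) (fun F _ => F.erase a) ?_ ?_ ?_ ?_
    · intro F hF
      simp only [Finset.mem_filter, mem_contraction] at hF ⊢
      refine ⟨⟨hF.1.2, ?_⟩, by simp⟩
      rw [Finset.card_insert_of_notMem hF.1.1]
      push_cast; linarith [hF.2]
    · intro F hF
      simp only [Finset.mem_filter, mem_contraction, not_not] at hF ⊢
      have := Finset.card_erase_add_one hF.2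
      refine ⟨⟨by simp, by rw [Finset.insert_erase hF.2]; exact hF.1.1⟩, by omega⟩
    · intro F hF
      simp only [Finset.mem_filter, mem_contraction] at hF
      exact Finset.erase_insert hF.1.1
    · intro F hF
      simp only [Finset.mem_filter, not_not] at hF
      exact Finset.insert_erase hF.2
  have h2 : faceNumber (deletion Φ a) i =
      ((Φ.filter fun F => (F.card : ℤ) - 1 = i).filter fun F => a ∉ F).card := by
    rw [faceNumber, deletion, Finset.filter_comm]
  rw [h1, h2, Finset.card_filter_add_card_filter_not, faceNumber]

/-- Outside the reduction, Φ is a union of pairs {F, F ∪ a}, so its deletion and contraction by a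
are both the base of the star. -/
theorem faceNumber_eq_add_reduction (Φ : Finset (Finset α)) (a : α) (i : ℤ) :
    faceNumber Φ i = faceNumber (starBase Φ a) i + faceNumber (starBase Φ a) (i - 1) +
      faceNumber (reduction Φ a) i := by
  have h1 : deletion (Φ \ reduction Φ a) a = starBase Φ a := by
    ext F
    simp only [mem_deletion, mem_starBase, Finset.mem_sdiff, mem_reduction]
    tauto
  have h2 : contraction (Φ \ reduction Φ a) a = starBase Φ a := by
    ext F
    simp only [mem_contraction, mem_starBase, Finset.mem_sdiff, mem_reduction,
      Finset.mem_insert_self]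
    refine and_congr_right fun hF => ?_
    rw [Finset.erase_insert hF]
    tauto
  have h3 := faceNumber_eq_add (Φ \ reduction Φ a) a i
  rw [h1, h2] at h3
  rw [← h3, faceNumber, faceNumber, faceNumber, ← Finset.card_union_of_disjoint,
    ← Finset.filter_union, Finset.sdiff_union_of_subset]
  · exact fun F hF => (mem_reduction.1 hF).1
  · exact Finset.disjoint_filter_filter Finset.sdiff_disjoint

/-- On spectra: replacing an eigenvalue 0 by 1 for each i-face of Φ||a turns s_i(Φ), enlarged by as
many ones and zeros respectively, into the union of s_i(Φ-a) and s_{i-1}(Φ/a) raised by one. -/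
theorem IsNearConeInterval.charpoly_laplacian {E : Finset α} {a : α} {Φ : Finset (Finset α)}
    (h : IsNearConeInterval E a Φ) (haE : a ∈ E) (hmin : ∀ x ∈ E, a ≤ x) (i : ℤ) :
    (laplacian Φ i).charpoly * (X - C 1) ^ faceNumber (reduction Φ a) i =
      X ^ faceNumber (reduction Φ a) i * (1 + laplacian (deletion Φ a) i).charpoly *
        (1 + laplacian (contraction Φ a) (i - 1)).charpoly := by
  have hdE : ∀ F ∈ deletion Φ a, F ⊆ E := fun F hF => h.subset (mem_deletion.1 hF).1
  have hcE : ∀ F ∈ contraction Φ a, F ⊆ E := fun F hF =>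
    (Finset.subset_insert _ _).trans (h.subset (mem_contraction.1 hF).2)
  have eΦ := charpoly_extLaplacian (fun F hF => h.subset hF) i
  have eA := charpoly_one_add_extLaplacian hdE i
  have eC := charpoly_one_add_extLaplacian hcE (i - 1)
  have fΦ := charpoly_extLaplacian_eq_mul (E := E) (Φ := Φ)
    (fun G hG F hF H h1 h2 => h.convex hG hF h1.1 h2.1) i
  have fA := charpoly_one_add_extLaplacian_eq_mul (E := E) (Φ := deletion Φ a)
    (fun G hG F hF H h1 h2 => by
      rw [mem_deletion] at *
      exact ⟨h.convex hG.1 hF.1 h1.1 h2.1, fun h' => hF.2 (h2.1 h')⟩) i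
  have fC := charpoly_one_add_extLaplacian_eq_mul (E := E) (Φ := contraction Φ a)
    (fun G hG F hF H h1 h2 => by
      rw [mem_contraction] at *
      exact ⟨fun h' => hF.1 (h2.1 h'), h.convex hG.2 hF.2 (Finset.insert_subset_insert _ h1.1)
        (Finset.insert_subset_insert _ h2.1)⟩) (i - 1)
  obtain ⟨W₁, hW₁, -, hW₁'⟩ := h.charpoly_boundary haE hmin (i + 1)
  obtain ⟨W₀, -, hW₀, hW₀'⟩ := h.charpoly_boundary haE hmin i
  rw [hW₁, hW₀] at fΦ
  -- W₁ involves A in dimension i+1 and D in dimension i; W₀ involves A in dimension i and D in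
  -- dimension i-1. Regrouping gives the Laplacians of Φ-a and Φ/a, once MMᵀ and MᵀM are
  -- interchanged where necessary.
  rw [add_sub_cancel_right] at hW₁'
  rw [sub_add_cancel, charpoly_one_add_mul_comm] at fC
  rw [charpoly_one_add_mul_comm (extBoundary E (deletion Φ a) i)ᵀ] at fA
  have n₁ := faceNumber_eq_add_reduction Φ a i
  have n₂ := faceNumber_eq_add Φ a i
  set N := Fintype.card (Subsets E)
  set b₁ := faceNumber (starBase Φ a) i
  set b₀ := faceNumber (starBase Φ a) (i - 1)
  set r := faceNumber (reduction Φ a) i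
  set m := faceNumber (deletion Φ a) i
  set c := faceNumber (contraction Φ a) (i - 1)
  have hX : (X : ℝ[X]) ≠ 0 := X_ne_zero
  have hY : (X - C 1 : ℝ[X]) ≠ 0 := X_sub_C_ne_zero 1
  generalize (X - C 1 : ℝ[X]) = y at *
  generalize (X : ℝ[X]) = x at *
  have hmc : m + c = b₁ + b₀ + r := by omega
  rw [n₁] at eΦ
  -- The common monomial absorbs all padding by zeros and ones; it is nonzero, so it cancels at the
  -- end.
  have key : x ^ (2 * N + b₁ + b₀) * y ^ (4 * N + b₁ + b₀) *
      ((laplacian Φ i).charpoly * y ^ r) = x ^ (2 * N + b₁ + b₀) * y ^ (4 * N + b₁ + b₀) *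
      (x ^ r * (1 + laplacian (deletion Φ a) i).charpoly *
        (1 + laplacian (contraction Φ a) (i - 1)).charpoly) := by
    have hy : y ^ (b₁ + b₀ + r) = y ^ m * y ^ c := by rw [← hmc, pow_add]
    generalize (laplacian Φ i).charpoly = χ at *
    generalize (1 + laplacian (deletion Φ a) i).charpoly = χA at *
    generalize (1 + laplacian (contraction Φ a) (i - 1)).charpoly = χC at *
    generalize (extLaplacian E Φ i).charpoly = l at *
    generalize (1 + extLaplacian E (deletion Φ a) i).charpoly = lA at *
    generalize (1 + extLaplacian E (contraction Φ a) (i - 1)).charpoly = lC at *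
    calc x ^ (2 * N + b₁ + b₀) * y ^ (4 * N + b₁ + b₀) * (χ * y ^ r)
        = x ^ (N + b₁ + b₀) * y ^ (4 * N) * y ^ (b₁ + b₀ + r) * (x ^ N * χ) := by ring
      _ = x ^ (b₁ + b₀) * y ^ (4 * N) * y ^ (b₁ + b₀ + r) * x ^ (b₁ + b₀ + r) * (x ^ N * l) := by
        rw [← eΦ]; ring
      _ = x ^ (b₁ + b₀ + r) * y ^ (b₁ + b₀ + r) * (x ^ b₁ * y ^ (2 * N) * W₁) *
          (x ^ b₀ * y ^ (2 * N) * W₀) := by rw [fΦ]; ring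
      _ = x ^ (2 * N + b₁ + b₀ + r) * y ^ (b₁ + b₀) * y ^ (b₁ + b₀ + r) *
          ((y ^ N * lA) * (y ^ N * lC)) := by rw [hW₁', hW₀', fA, fC]; ring
      _ = x ^ (2 * N + b₁ + b₀ + r) * y ^ (2 * N + b₁ + b₀) *
          ((y ^ m * lA) * (y ^ c * lC)) := by rw [hy]; ring
      _ = _ := by rw [eA, eC]; ring
  exact mul_left_cancel₀ (mul_ne_zero (pow_ne_zero _ hX) (pow_ne_zero _ hY)) key

/-! ### The recursion with respect to the apex -/

/-- The sum of `q ^ c` over the eigenvalues `c` of `L_i`. -/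
def spectrumSum (Φ : Finset (Finset α)) (i : ℤ) : AddMonoidAlgebra ℤ ℝ :=
  ((laplacianSpectrum Φ i).map qpow).sum

theorem spectrumSum_eq_zero {Φ : Finset (Finset α)} {i : ℤ}
    (h : ∀ F ∈ Φ, (F.card : ℤ) - 1 ≠ i) : spectrumSum Φ i = 0 := by
  have : IsEmpty (Faces Φ i) := ⟨fun F => h _ (Finset.mem_filter.1 F.2).1 (Finset.mem_filter.1 F.2).2⟩
  rw [spectrumSum, laplacianSpectrum, Matrix.charpoly, Matrix.det_isEmpty]
  simp

theorem coeff_spectrumPoly (Φ : Finset (Finset α)) (n : ℕ) :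
    (spectrumPoly Φ).coeff n = spectrumSum Φ ((n : ℤ) - 1) := by
  rw [spectrumPoly, Polynomial.finsetSum_coeff]
  have : ∀ i, (X ^ i * C ((laplacianSpectrum Φ ((i : ℤ) - 1)).map qpow).sum).coeff n =
      if n = i then spectrumSum Φ ((n : ℤ) - 1) else 0 := by
    intro i
    rw [X_pow_mul, coeff_C_mul_X_pow]
    split_ifs with h
    · rw [h]; rfl
    · rfl
  simp only [this, Finset.sum_ite_eq, Finset.mem_range]
  split_ifs with h
  · rfl
  · refine (spectrumSum_eq_zero fun F hF hc => h ?_).symm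
    have := Finset.le_sup (f := Finset.card) hF
    omega

theorem roots_charpoly_one_add {T : Type*} [Fintype T] [DecidableEq T] (M : Matrix T T ℝ) :
    (1 + M).charpoly.roots = M.charpoly.roots.map fun c => 1 + c := by
  have := roots_comp_C_mul_X_add_C M.charpoly 1 (-1) isUnit_one
  rw [charpoly_one_add, show (X - C 1 : ℝ[X]) = C 1 * X + C (-1) by simp [sub_eq_add_neg], this]
  refine Multiset.map_congr rfl fun c _ => ?_
  simp [add_comm]

theorem qpow_add (b c : ℝ) : qpow (b + c) = qpow b * qpow c := by
  simp [qpow, AddMonoidAlgebra.single_mul_single]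

theorem qpow_zero : qpow 0 = 1 := rfl

theorem sum_map_qpow_one_add (s : Multiset ℝ) :
    ((s.map fun c => 1 + c).map qpow).sum = qpow 1 * (s.map qpow).sum := by
  rw [Multiset.map_map, ← Multiset.sum_map_mul_left]
  simp [qpow_add]

section Apex

variable {E : Finset α} {a : α} {Φ : Finset (Finset α)}

/-- If F and F \ v are both in Φ, then F lies in the star when a ∈ F, and F \ v does when a ∉ F. So
the boundaries of Φ||a vanish and all eigenvalues are 0. -/
theorem IsNearConeInterval.spectrumSum_reduction (h : IsNearConeInterval E a Φ) (i : ℤ) :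
    spectrumSum (reduction Φ a) i = faceNumber (reduction Φ a) i := by
  have key : ∀ j k : ℤ, boundary (reduction Φ a) j k = 0 := by
    intro j k
    ext G F
    by_contra hne
    obtain ⟨v, hv, hv'⟩ := exists_of_incidence_ne_zero hne
    have hG := mem_reduction.1 (Finset.mem_filter.1 G.2).1
    have hF := mem_reduction.1 (Finset.mem_filter.1 F.2).1
    rw [← hv'] at hG
    by_cases ha : a ∈ F.1
    · exact hF.2.2 ha (h.erase_mem hF.1 ha hv hG.1)
    · exact hG.2.1 (fun h' => ha (Finset.mem_of_mem_erase h')) (h.insert_erase_mem hF.1 hv hG.1)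
  have : laplacian (reduction Φ a) i = 0 := by simp [laplacian, key]
  rw [spectrumSum, laplacianSpectrum, this, Matrix.charpoly_zero, roots_X_pow, card_faces]
  simp [qpow_zero, Multiset.map_nsmul, Multiset.sum_nsmul]

theorem IsNearConeInterval.spectrumSum_eq (h : IsNearConeInterval E a Φ) (haE : a ∈ E)
    (hmin : ∀ x ∈ E, a ≤ x) (i : ℤ) :
    spectrumSum Φ i = qpow 1 * spectrumSum (deletion Φ a) i +
      qpow 1 * spectrumSum (contraction Φ a) (i - 1) +
      (1 - qpow 1) * spectrumSum (reduction Φ a) i := by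
  -- Root multisets are additive on nonzero products, so no splitting over ℝ is required.
  have h0 := congrArg Polynomial.roots (h.charpoly_laplacian haE hmin i)
  have hmonic : ∀ {T : Type _} [Fintype T] [DecidableEq T] (M : Matrix T T ℝ), M.charpoly ≠ 0 :=
    fun M => M.charpoly_monic.ne_zero
  have hX : (X : ℝ[X]) ^ faceNumber (reduction Φ a) i ≠ 0 := pow_ne_zero _ X_ne_zero
  have hY : (X - C 1 : ℝ[X]) ^ faceNumber (reduction Φ a) i ≠ 0 :=
    pow_ne_zero _ (X_sub_C_ne_zero 1)
  rw [roots_mul (mul_ne_zero (hmonic _) hY), roots_mul (mul_ne_zero (mul_ne_zero hX (hmonic _))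
    (hmonic _)), roots_mul (mul_ne_zero hX (hmonic _)), roots_pow, roots_X_sub_C, roots_X_pow,
    roots_charpoly_one_add, roots_charpoly_one_add] at h0
  have h1 := congrArg (fun s : Multiset ℝ => (s.map qpow).sum) h0
  simp only [Multiset.map_add, Multiset.sum_add, sum_map_qpow_one_add, Multiset.map_nsmul,
    Multiset.sum_nsmul, Multiset.map_singleton, Multiset.sum_singleton, qpow_zero,
    nsmul_eq_mul, mul_one] at h1
  change spectrumSum Φ i + _ = _ + qpow 1 * spectrumSum (deletion Φ a) i +
    qpow 1 * spectrumSum (contraction Φ a) (i - 1) at h1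
  rw [h.spectrumSum_reduction]
  linear_combination h1

theorem IsNearConeInterval.spectralRecursionAt (h : IsNearConeInterval E a Φ) (haE : a ∈ E)
    (hmin : ∀ x ∈ E, a ≤ x) : SpectralRecursionAt Φ a := by
  rw [SpectralRecursionAt]
  ext1 n
  have h0 := h.spectrumSum_eq haE hmin ((n : ℤ) - 1)
  rw [show (1 - C (qpow 1) : (AddMonoidAlgebra ℤ ℝ)[X]) = C (1 - qpow 1) by simp]
  rw [coeff_add, coeff_add, coeff_C_mul, coeff_C_mul, mul_assoc, coeff_C_mul]
  rw [coeff_spectrumPoly, coeff_spectrumPoly, coeff_spectrumPoly, h0]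
  congr 3
  cases n with
  | zero =>
    rw [coeff_X_mul_zero]
    -- The contraction would contribute in dimension -2, where there are no faces.
    exact spectrumSum_eq_zero fun F _ => by simp; omega
  | succ n =>
    rw [coeff_X_mul, coeff_spectrumPoly]
    congr 1
    push_cast; ring

/-- The generating polynomial of the face numbers. -/
def facePoly (Φ : Finset (Finset α)) : Polynomial (AddMonoidAlgebra ℤ ℝ) :=
  ∑ F ∈ Φ, X ^ F.card

theorem coeff_facePoly {α : Type*} (Φ : Finset (Finset α)) (n : ℕ) :
    (facePoly Φ).coeff n = faceNumber Φ ((n : ℤ) - 1) := by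
  simp only [facePoly, finsetSum_coeff, coeff_X_pow, faceNumber, Finset.card_filter,
    Nat.cast_sum, Nat.cast_ite, Nat.cast_one, Nat.cast_zero]
  refine Finset.sum_congr rfl fun F _ => if_congr ?_ rfl rfl
  omega

theorem IsNearConeInterval.spectrumPoly_reduction (h : IsNearConeInterval E a Φ) :
    spectrumPoly (reduction Φ a) = facePoly (reduction Φ a) := by
  ext1 n
  rw [coeff_spectrumPoly, coeff_facePoly, h.spectrumSum_reduction]

end Apex

/-! ### Deletion, contraction and reduction with respect to two vertices -/

theorem deletion_comm (Φ : Finset (Finset α)) (a e : α) :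
    deletion (deletion Φ a) e = deletion (deletion Φ e) a := by
  ext F; simp only [mem_deletion]; tauto

theorem contraction_deletion_comm {a e : α} (hae : a ≠ e) (Φ : Finset (Finset α)) :
    contraction (deletion Φ a) e = deletion (contraction Φ e) a := by
  ext F
  simp only [mem_deletion, mem_contraction, Finset.mem_insert, hae, false_or]
  tauto

theorem contraction_comm {a e : α} (hae : a ≠ e) (Φ : Finset (Finset α)) :
    contraction (contraction Φ a) e = contraction (contraction Φ e) a := by
  ext F
  simp only [mem_contraction, Finset.mem_insert, hae, hae.symm, false_or,
    Finset.insert_comm a e F]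
  tauto

theorem reduction_deletion_comm {a e : α} (hae : a ≠ e) (Φ : Finset (Finset α)) :
    reduction (deletion Φ a) e = deletion (reduction Φ e) a := by
  ext F
  simp only [mem_reduction, mem_deletion, Finset.mem_insert, Finset.mem_erase, hae, false_or,
    ne_eq, not_false_eq_true, true_and]
  tauto

theorem reduction_contraction_comm {a e : α} (hae : a ≠ e) (Φ : Finset (Finset α)) :
    reduction (contraction Φ a) e = contraction (reduction Φ e) a := by
  ext F
  simp only [mem_reduction, mem_contraction, Finset.mem_insert, Finset.mem_erase, hae, hae.symm,
    false_or, ne_eq, not_false_eq_true, true_and, Finset.insert_comm a e F,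
    Finset.erase_insert_of_ne hae]
  tauto

theorem facePoly_eq_add (Φ : Finset (Finset α)) (a : α) :
    facePoly Φ = facePoly (deletion Φ a) + X * facePoly (contraction Φ a) := by
  ext1 n
  rw [coeff_add, coeff_facePoly, coeff_facePoly, faceNumber_eq_add Φ a, Nat.cast_add]
  congr 1
  cases n with
  | zero =>
    rw [coeff_X_mul_zero, faceNumber, Finset.filter_false_of_mem, Finset.card_empty, Nat.cast_zero]
    intro F _
    simp; omega
  | succ n =>
    rw [coeff_X_mul, coeff_facePoly]
    congr 2
    push_cast; ring

theorem facePoly_eq_sum_ite {Φ S : Finset (Finset α)} (h : Φ ⊆ S) :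
    facePoly Φ = ∑ F ∈ S, if F ∈ Φ then X ^ F.card else 0 := by
  rw [← Finset.sum_filter, Finset.filter_mem_eq_inter, Finset.inter_eq_right.2 h, facePoly]

/-- Groups subsets of E into squares F, F ∪ a, F ∪ e, F ∪ {a, e}, so that reductions at a and e can
be compared one square at a time. -/
theorem facePoly_eq_sum_squares {E : Finset α} {Φ : Finset (Finset α)} (hE : ∀ F ∈ Φ, F ⊆ E)
    {a e : α} (hae : a ≠ e) :
    facePoly Φ = ∑ F ∈ ((E.erase a).erase e).powerset, X ^ F.card *
      ((if F ∈ Φ then 1 else 0) + X * (if insert a F ∈ Φ then 1 else 0) +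
        X * (if insert e F ∈ Φ then 1 else 0) +
        X ^ 2 * (if insert a (insert e F) ∈ Φ then 1 else 0)) := by
  rw [facePoly_eq_add Φ a, facePoly_eq_add (deletion Φ a) e,
    facePoly_eq_add (contraction Φ a) e]
  have hsub : ∀ F, a ∉ F → e ∉ F → F ⊆ E → F ∈ ((E.erase a).erase e).powerset := by
    intro F h1 h2 h3
    exact Finset.mem_powerset.2 (Finset.subset_erase.2 ⟨Finset.subset_erase.2 ⟨h3, h1⟩, h2⟩)
  rw [facePoly_eq_sum_ite (Φ := deletion (deletion Φ a) e) fun F hF => by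
      simp only [mem_deletion] at hF
      exact hsub F hF.1.2 hF.2 (hE F hF.1.1),
    facePoly_eq_sum_ite (Φ := contraction (deletion Φ a) e) fun F hF => by
      simp only [mem_deletion, mem_contraction, Finset.mem_insert, not_or] at hF
      exact hsub F hF.2.2.2 hF.1 ((Finset.subset_insert _ _).trans (hE _ hF.2.1)),
    facePoly_eq_sum_ite (Φ := deletion (contraction Φ a) e) fun F hF => by
      simp only [mem_deletion, mem_contraction] at hF
      exact hsub F hF.1.1 hF.2 ((Finset.subset_insert _ _).trans (hE _ hF.1.2)),
    facePoly_eq_sum_ite (Φ := contraction (contraction Φ a) e) fun F hF => by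
      simp only [mem_contraction, Finset.mem_insert, not_or] at hF
      exact hsub F hF.2.1.2 hF.1 ((Finset.subset_insert _ _).trans
        ((Finset.subset_insert _ _).trans (hE _ hF.2.2)))]
  simp only [Finset.mul_sum, ← Finset.sum_add_distrib]
  refine Finset.sum_congr rfl fun F hF => ?_
  have hF' := Finset.mem_powerset.1 hF
  have h1 : a ∉ F := fun h => by simpa using hF' h
  have h2 : e ∉ F := fun h => by simpa using hF' h
  simp only [mem_deletion, mem_contraction, Finset.mem_insert, h1, h2, hae, or_self,
    not_false_eq_true, and_true, true_and]
  split_ifs <;> ring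

/-! ### Intervals of near-cones and a second vertex -/

theorem deletion_sdiff (Δ Δ' : Finset (Finset α)) (e : α) :
    deletion (Δ \ Δ') e = deletion Δ e \ deletion Δ' e := by
  ext F; simp only [mem_deletion, Finset.mem_sdiff]; tauto

theorem contraction_sdiff (Δ Δ' : Finset (Finset α)) (e : α) :
    contraction (Δ \ Δ') e = contraction Δ e \ contraction Δ' e := by
  ext F; simp only [mem_contraction, Finset.mem_sdiff]; tauto

theorem deletion_mono {Δ Δ' : Finset (Finset α)} (h : Δ' ⊆ Δ) (e : α) :
    deletion Δ' e ⊆ deletion Δ e := fun F hF => by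
  rw [mem_deletion] at *; exact ⟨h hF.1, hF.2⟩

theorem contraction_mono {Δ Δ' : Finset (Finset α)} (h : Δ' ⊆ Δ) (e : α) :
    contraction Δ' e ⊆ contraction Δ e := fun F hF => by
  rw [mem_contraction] at *; exact ⟨hF.1, h hF.2⟩

theorem IsComplex.deletion {E : Finset α} {Δ : Finset (Finset α)} (h : IsComplex E Δ) (e : α) :
    IsComplex (E.erase e) (deletion Δ e) := by
  refine ⟨fun F hF => ?_, fun G H hGH hH => ?_⟩
  · rw [mem_deletion] at hF
    exact Finset.subset_erase.2 ⟨h.1 F hF.1, hF.2⟩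
  · rw [mem_deletion] at *
    exact ⟨h.2 G H hGH hH.1, fun h' => hH.2 (hGH h')⟩

theorem IsComplex.contraction {E : Finset α} {Δ : Finset (Finset α)} (h : IsComplex E Δ) (e : α) :
    IsComplex (E.erase e) (contraction Δ e) := by
  refine ⟨fun F hF => ?_, fun G H hGH hH => ?_⟩
  · rw [mem_contraction] at hF
    exact Finset.subset_erase.2 ⟨(Finset.subset_insert _ _).trans (h.1 _ hF.2), hF.1⟩
  · rw [mem_contraction] at *
    exact ⟨fun h' => hH.1 (hGH h'), h.2 _ _ (Finset.insert_subset_insert _ hGH) hH.2⟩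

theorem insert_insert_erase_mem {Δ : Finset (Finset α)} {e u v : α} {H : Finset α}
    (hev : e ≠ v) (h : insert u ((insert e H).erase v) ∈ Δ) :
    insert e (insert u (H.erase v)) ∈ Δ := by
  rwa [Finset.erase_insert_of_ne hev, Finset.insert_comm] at h

theorem IsNearCone.deletion {E : Finset α} {a e : α} (hae : a ≠ e) {Δ : Finset (Finset α)}
    (h : IsNearCone E a Δ) : IsNearCone (E.erase e) a (deletion Δ e) := by
  refine ⟨h.isComplex.deletion e, fun H hH v hv => ?_⟩
  rw [mem_deletion] at *
  refine ⟨h.replace H hH.1 v hv, fun h' => ?_⟩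
  rcases Finset.mem_insert.1 h' with h' | h'
  · exact hae h'.symm
  · exact hH.2 (Finset.mem_of_mem_erase h')

theorem IsNearCone.contraction {E : Finset α} {a e : α} (hae : a ≠ e) {Δ : Finset (Finset α)}
    (h : IsNearCone E a Δ) : IsNearCone (E.erase e) a (contraction Δ e) := by
  refine ⟨h.isComplex.contraction e, fun H hH v hv => ?_⟩
  rw [mem_contraction] at *
  refine ⟨fun h' => ?_, insert_insert_erase_mem (fun h' => hH.1 (h' ▸ hv))
    (h.replace _ hH.2 v (Finset.mem_insert_of_mem hv))⟩
  rcases Finset.mem_insert.1 h' with h' | h'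
  · exact hae h'.symm
  · exact hH.1 (Finset.mem_of_mem_erase h')

theorem IsNearConeInterval.deletion {E : Finset α} {a e : α} (hae : a ≠ e)
    {Φ : Finset (Finset α)} (h : IsNearConeInterval E a Φ) :
    IsNearConeInterval (E.erase e) a (deletion Φ e) := by
  obtain ⟨Δ, Δ', h1, h2, h3, rfl⟩ := h
  exact ⟨_, _, h1.deletion hae, h2.deletion hae, deletion_mono h3 e, deletion_sdiff _ _ _⟩

theorem IsNearConeInterval.contraction {E : Finset α} {a e : α} (hae : a ≠ e)
    {Φ : Finset (Finset α)} (h : IsNearConeInterval E a Φ) :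
    IsNearConeInterval (E.erase e) a (contraction Φ e) := by
  obtain ⟨Δ, Δ', h1, h2, h3, rfl⟩ := h
  exact ⟨_, _, h1.contraction hae, h2.contraction hae, contraction_mono h3 e,
    contraction_sdiff _ _ _⟩

theorem IsNearConeInterval.reduction {E : Finset α} {a e : α} (hae : a ≠ e)
    {Φ : Finset (Finset α)} (h : IsNearConeInterval E a Φ) :
    IsNearConeInterval E a (reduction Φ e) := by
  obtain ⟨Δ, Δ', h1, h2, h3, rfl⟩ := h
  have c1 := h1.isComplex.2
  have c2 := h2.isComplex.2
  -- From each pair {F, F ∪ e} inside Φ, the upper member is removed from Δ and the lower one is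
  -- added to Δ'. Both families remain near-cones.
  refine ⟨Δ.filter fun F => e ∈ F → F.erase e ∈ Δ',
    Δ.filter fun F => (e ∉ F → insert e F ∈ Δ ∨ F ∈ Δ') ∧ (e ∈ F → F ∈ Δ'),
    ⟨⟨fun F hF => h1.isComplex.1 F (Finset.mem_filter.1 hF).1, fun G H hGH hH => ?_⟩,
      fun H hH v hv => ?_⟩,
    ⟨⟨fun F hF => h1.isComplex.1 F (Finset.mem_filter.1 hF).1, fun G H hGH hH => ?_⟩,
      fun H hH v hv => ?_⟩, fun F hF => ?_, ?_⟩
  · rw [Finset.mem_filter] at *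
    exact ⟨c1 G H hGH hH.1, fun he => c2 _ _ (Finset.erase_subset_erase e hGH) (hH.2 (hGH he))⟩
  · rw [Finset.mem_filter] at *
    refine ⟨h1.replace H hH.1 v hv, fun he => ?_⟩
    have he' : e ≠ v ∧ e ∈ H := by simpa [hae.symm] using he
    have := h2.replace _ (hH.2 he'.2) v (Finset.mem_erase.2 ⟨he'.1.symm, hv⟩)
    rwa [Finset.erase_insert_of_ne hae, Finset.erase_right_comm]
  · rw [Finset.mem_filter] at *
    refine ⟨c1 G H hGH hH.1, fun he => ?_, fun he => c2 G H hGH (hH.2.2 (hGH he))⟩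
    by_cases heH : e ∈ H
    · exact Or.inr (c2 G H hGH (hH.2.2 heH))
    · exact (hH.2.1 heH).imp (c1 _ _ (Finset.insert_subset_insert e hGH)) (c2 G H hGH)
  · rw [Finset.mem_filter] at *
    refine ⟨h1.replace H hH.1 v hv, ?_⟩
    by_cases heH : e ∈ H
    · have := h2.replace H (hH.2.2 heH) v hv
      exact ⟨fun _ => Or.inr this, fun _ => this⟩
    · have hev : e ≠ v := fun h' => heH (h' ▸ hv)
      refine ⟨fun _ => (hH.2.1 heH).imp (fun h' => ?_) fun h' => h2.replace H h' v hv,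
        fun he => absurd he ?_⟩
      · exact insert_insert_erase_mem hev (h1.replace _ h' v (Finset.mem_insert_of_mem hv))
      · simp [hae.symm, heH]
  · rw [Finset.mem_filter] at *
    exact ⟨hF.1, fun he => c2 _ _ (Finset.erase_subset e F) (hF.2.2 he)⟩
  · ext F
    simp only [mem_reduction, Finset.mem_sdiff, Finset.mem_filter]
    have i1 : insert e F ∈ Δ' → F ∈ Δ' := c2 _ _ (Finset.subset_insert e F)
    have i2 : F ∈ Δ → F.erase e ∈ Δ := c1 _ _ (Finset.erase_subset e F)
    by_cases he : e ∈ F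
    · simp only [he, not_true_eq_false, false_imp_iff, true_imp_iff, true_and]
      tauto
    · simp only [he, not_false_eq_true, false_imp_iff, true_imp_iff, and_true]
      tauto

/-- The reductions with respect to two vertices, one of them the apex, have as many faces of
each dimension as the reduction with respect to the apex. -/
theorem IsNearConeInterval.facePoly_reduction_reduction {E : Finset α} {a e : α} (hae : a ≠ e)
    {Φ : Finset (Finset α)} (h : IsNearConeInterval E a Φ) :
    facePoly (ShiftedInterval.reduction (ShiftedInterval.reduction Φ e) a) =
      facePoly (ShiftedInterval.reduction Φ a) := by
  have hE : ∀ F ∈ Φ, F ⊆ E := fun F hF => h.subset hF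
  rw [facePoly_eq_sum_squares (E := E) (fun F hF => hE F (mem_reduction.1
    (mem_reduction.1 hF).1).1) hae, facePoly_eq_sum_squares (E := E)
    (fun F hF => hE F (mem_reduction.1 hF).1) hae]
  refine Finset.sum_congr rfl fun F hF => ?_
  refine congrArg (HMul.hMul (X ^ F.card)) ?_
  have hF' := Finset.mem_powerset.1 hF
  have ha : a ∉ F := fun h => by simpa using hF' h
  have he : e ∉ F := fun h => by simpa using hF' h
  have hae' := hae.symm
  -- These constraints limit how Φ meets a square. In the patterns left, the survivors may differ,
  -- as F ∪ e against F ∪ a, but their sizes agree.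
  have s1 : F ∈ Φ → insert e F ∈ Φ → insert a F ∈ Φ := fun h1 h2 => by
    have := h.insert_erase_mem h2 (Finset.mem_insert_self e F) (by rwa [Finset.erase_insert he])
    rwa [Finset.erase_insert he] at this
  have s2 : F ∈ Φ → insert a (insert e F) ∈ Φ → insert a F ∈ Φ ∧ insert e F ∈ Φ := fun h1 h2 =>
    ⟨h.convex h1 h2 (Finset.subset_insert _ _)
      (Finset.insert_subset_insert _ (Finset.subset_insert _ _)),
      h.convex h1 h2 (Finset.subset_insert _ _) (Finset.subset_insert _ _)⟩
  have s3 : insert a F ∈ Φ → insert a (insert e F) ∈ Φ → insert e F ∈ Φ := fun h1 h2 => by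
    have := h.erase_mem (v := e) h2 (Finset.mem_insert_self _ _) (by simp)
      (by rwa [Finset.erase_insert_of_ne hae, Finset.erase_insert he])
    rwa [Finset.erase_insert (by simp [hae, ha])] at this
  simp only [mem_reduction, Finset.mem_insert, ha, he, hae, hae', or_self, or_false,
    not_false_eq_true, not_true_eq_false, or_true, false_imp_iff, true_imp_iff, and_true, true_and,
    Finset.erase_insert, Finset.erase_insert_of_ne hae, Finset.insert_comm e a F]
  clear hE hF hF' ha he h hae hae'
  by_cases h0 : F ∈ Φ <;> by_cases h1 : insert a F ∈ Φ <;> by_cases h2 : insert e F ∈ Φ <;>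
    by_cases h3 : insert a (insert e F) ∈ Φ <;>
    simp only [h0, h1, h2, h3, false_imp_iff, and_self, and_true, and_false,
      imp_self, imp_false, not_true_eq_false] at s1 s2 s3 <;>
    simp only [h0, h1, h2, h3, not_true_eq_false, not_false_eq_true, and_self, and_true,
      and_false, if_true, if_false, mul_zero, zero_add, add_zero]

/-! ### Shifted intervals -/

/-- Replacing a vertex by a smaller one gives a smaller set in the componentwise order. -/
theorem compLE_insert_erase {H : Finset α} {u v : α} (hv : v ∈ H) (hu : u ∉ H) (huv : u < v) :
    CompLE (insert u (H.erase v)) H := by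
  have hu' : u ∉ H.erase v := fun h => hu (Finset.mem_of_mem_erase h)
  have hcard : (insert u (H.erase v)).card = H.card := by
    rw [Finset.card_insert_of_notMem hu', Finset.card_erase_add_one hv]
  refine ⟨H.card, hcard, rfl, fun p => ?_⟩
  -- Count elements up to the p-th element of H: there are at least p + 1 in H, and at most p in the
  -- new set if the claim fails. But replacing v by a smaller u cannot lower this count.
  by_contra! hlt
  set f := (insert u (H.erase v)).orderEmbOfFin hcard with hf
  set g := H.orderEmbOfFin rfl with hg
  have h1 : (p : ℕ) + 1 ≤ (H.filter (· ≤ g p)).card := by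
    rw [← Fin.card_Iic, ← Finset.card_map g.toEmbedding]
    refine Finset.card_le_card fun y hy => ?_
    obtain ⟨q, hq, rfl⟩ := Finset.mem_map.1 hy
    exact Finset.mem_filter.2 ⟨Finset.orderEmbOfFin_mem _ _ _, g.monotone (Finset.mem_Iic.1 hq)⟩
  have h2 : ((insert u (H.erase v)).filter (· ≤ g p)).card ≤ p := by
    rw [← Fin.card_Iio, ← Finset.card_map f.toEmbedding]
    refine Finset.card_le_card fun y hy => ?_
    obtain ⟨hy1, hy2⟩ := Finset.mem_filter.1 hy
    have : y ∈ Set.range f := by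
      rw [hf, Finset.range_orderEmbOfFin]; exact hy1
    obtain ⟨q, rfl⟩ := this
    exact Finset.mem_map.2 ⟨q, Finset.mem_Iio.2 (f.lt_iff_lt.1 (hy2.trans_lt hlt)), rfl⟩
  have h3 : (H.filter (· ≤ g p)).card ≤ ((insert u (H.erase v)).filter (· ≤ g p)).card := by
    by_cases hvp : v ≤ g p
    · rw [Finset.filter_insert, if_pos (huv.le.trans hvp), Finset.filter_erase,
        Finset.card_insert_of_notMem (by simp [hu]), Finset.card_erase_add_one (by simp [hv, hvp])]
    · refine Finset.card_le_card fun y hy => ?_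
      obtain ⟨hy1, hy2⟩ := Finset.mem_filter.1 hy
      refine Finset.mem_filter.2 ⟨Finset.mem_insert_of_mem (Finset.mem_erase.2 ⟨?_, hy1⟩), hy2⟩
      rintro rfl
      exact hvp hy2
  omega

/-- A complex on `E` in which a vertex of a face can be replaced by any smaller vertex. -/
structure IsExchangeComplex (E : Finset α) (Δ : Finset (Finset α)) : Prop where
  isComplex : IsComplex E Δ
  exchange : ∀ H ∈ Δ, ∀ v ∈ H, ∀ u ∈ E, u < v → insert u (H.erase v) ∈ Δ

theorem IsShiftedComplex.isExchangeComplex {E : Finset α} {Δ : Finset (Finset α)}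
    (h : IsShiftedComplex E Δ) : IsExchangeComplex E Δ := by
  refine ⟨h.1, fun H hH v hv u hu huv => ?_⟩
  by_cases huH : u ∈ H
  · exact h.1.2 _ H (Finset.insert_subset huH (Finset.erase_subset _ _)) hH
  · exact h.2 _ H (Finset.insert_subset hu ((Finset.erase_subset _ _).trans (h.1.1 H hH)))
      (compLE_insert_erase hv huH huv) hH

namespace IsExchangeComplex

variable {E : Finset α} {Δ : Finset (Finset α)}

theorem isNearCone (h : IsExchangeComplex E Δ) {a : α} (ha : a ∈ E) (hmin : ∀ x ∈ E, a ≤ x) :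
    IsNearCone E a Δ := by
  refine ⟨h.isComplex, fun H hH v hv => ?_⟩
  rcases (hmin v (h.isComplex.1 H hH hv)).eq_or_lt with rfl | hav
  · rwa [Finset.insert_erase hv]
  · exact h.exchange H hH v hv a ha hav

theorem deletion (h : IsExchangeComplex E Δ) (e : α) :
    IsExchangeComplex (E.erase e) (deletion Δ e) := by
  refine ⟨h.isComplex.deletion e, fun H hH v hv u hu huv => ?_⟩
  rw [mem_deletion] at *
  rw [Finset.mem_erase] at hu
  refine ⟨h.exchange H hH.1 v hv u hu.2 huv, ?_⟩
  simp [hu.1.symm, hH.2]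

theorem contraction (h : IsExchangeComplex E Δ) (e : α) :
    IsExchangeComplex (E.erase e) (contraction Δ e) := by
  refine ⟨h.isComplex.contraction e, fun H hH v hv u hu huv => ?_⟩
  rw [mem_contraction] at *
  rw [Finset.mem_erase] at hu
  refine ⟨by simp [hu.1.symm, hH.1], insert_insert_erase_mem (fun h' => hH.1 (h' ▸ hv)) ?_⟩
  exact h.exchange _ hH.2 v (Finset.mem_insert_of_mem hv) u hu.2 huv

end IsExchangeComplex

/-- The recursion with respect to `e` follows from the recursion with respect to the apex `a`
of the interval and its minors by `e`, and with respect to `e` of its minors by `a`. -/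
theorem IsNearConeInterval.spectralRecursionAt_of_minors {E : Finset α} {a e : α}
    {Φ : Finset (Finset α)} (h : IsNearConeInterval E a Φ) (ha : a ∈ E)
    (hmin : ∀ x ∈ E, a ≤ x) (hae : a ≠ e)
    (hdel : SpectralRecursionAt (ShiftedInterval.deletion Φ a) e)
    (hcon : SpectralRecursionAt (ShiftedInterval.contraction Φ a) e) :
    SpectralRecursionAt Φ e := by
  have ha' : a ∈ E.erase e := Finset.mem_erase.2 ⟨hae, ha⟩
  have hmin' : ∀ x ∈ E.erase e, a ≤ x := fun x hx => hmin x (Finset.mem_of_mem_erase hx)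
  have hd := h.deletion hae
  have hc := h.contraction hae
  have hr := h.reduction hae
  have rΦ := h.spectralRecursionAt ha hmin
  have rd := hd.spectralRecursionAt ha' hmin'
  have rc := hc.spectralRecursionAt ha' hmin'
  have rr := hr.spectralRecursionAt ha hmin
  rw [SpectralRecursionAt, h.spectrumPoly_reduction] at rΦ
  rw [SpectralRecursionAt, hd.spectrumPoly_reduction] at rd
  rw [SpectralRecursionAt, hc.spectrumPoly_reduction] at rc
  rw [SpectralRecursionAt, hr.spectrumPoly_reduction] at rr
  rw [SpectralRecursionAt] at hdel hcon ⊢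
  rw [deletion_comm, contraction_deletion_comm hae, reduction_deletion_comm hae] at hdel
  rw [← contraction_deletion_comm hae.symm, contraction_comm hae,
    reduction_contraction_comm hae] at hcon
  have f1 := h.facePoly_reduction_reduction hae
  have f2 := facePoly_eq_add (ShiftedInterval.reduction Φ a) e
  rw [← reduction_deletion_comm hae.symm, ← reduction_contraction_comm hae.symm] at f2
  rw [f1] at rr
  rw [rΦ, rd, rc, rr, hdel, hcon]
  -- With f((Φ||e)||a) = f(Φ||a), the leftover (1-q) - (1-q)² = q(1-q) multiplies f(Φ||a), which is
  -- split by whether e is in the face.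
  linear_combination (1 - C (qpow 1)) * C (qpow 1) * f2

theorem spectralRecursionAt_of_isExchangeComplex {E : Finset α} {Δ Δ' : Finset (Finset α)}
    (h : IsExchangeComplex E Δ) (h' : IsExchangeComplex E Δ') (hsub : Δ' ⊆ Δ) {e : α}
    (he : e ∈ E) : SpectralRecursionAt (Δ \ Δ') e := by
  induction hn : E.card generalizing E Δ Δ' with
  | zero => rw [Finset.card_eq_zero.1 hn] at he; simp at he
  | succ n ih =>
    -- The apex is the least vertex of the current ground set, which loses a in the inductive step;
    -- minors by a keep the exchange property on the smaller ground set.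
    have ha : E.min' ⟨e, he⟩ ∈ E := E.min'_mem _
    have hmin : ∀ x ∈ E, E.min' ⟨e, he⟩ ≤ x := fun x hx => E.min'_le x hx
    generalize E.min' ⟨e, he⟩ = a at ha hmin
    have hΦ : IsNearConeInterval E a (Δ \ Δ') :=
      ⟨Δ, Δ', h.isNearCone ha hmin, h'.isNearCone ha hmin, hsub, rfl⟩
    by_cases hae : a = e
    · exact hae ▸ hΦ.spectralRecursionAt ha hmin
    · have he' : e ∈ E.erase a := Finset.mem_erase.2 ⟨Ne.symm hae, he⟩
      have hcard : (E.erase a).card = n := by rw [Finset.card_erase_of_mem ha, hn]; rfl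
      refine hΦ.spectralRecursionAt_of_minors ha hmin hae ?_ ?_
      · rw [deletion_sdiff]
        exact ih (h.deletion a) (h'.deletion a) (deletion_mono hsub a) he' hcard
      · rw [contraction_sdiff]
        exact ih (h.contraction a) (h'.contraction a) (contraction_mono hsub a) he' hcard

end ShiftedInterval

end

theorem theorem4 {α : Type*} [LinearOrder α] (E : Finset α) (Φ : Finset (Finset α))
    (hΦ : ShiftedInterval.IsShiftedInterval E Φ) :
    ShiftedInterval.SatisfiesSpectralRecursion E Φ := by
  obtain ⟨Δ, Δ', h, h', hsub, rfl⟩ := hΦ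
  intro e he
  exact ShiftedInterval.spectralRecursionAt_of_isExchangeComplex h.isExchangeComplex
    h'.isExchangeComplex hsub he
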